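/- Let $n,q,d,\Phi\ge 1$ be integers with $q\le n$, and let $\epsilon,\delta\in(0,1)$. In the all-cross-distances problem, Alice holds $n$ points $x_1,\dots,x_n\in\{-\Phi,\dots,\Phi\}^d$ and Bob holds $q$ points $y_1,\dots,y_q\in\{-\Phi,\dots,\Phi\}^d$ (integer coordinates). In the one-way communication model with private randomness, Alice computes from her points a (random) bit string, the sketch, and sends it to Bob; from the sketch, his own points and his own random bits, Bob reports numbers $E(i,j)$ such that, for all inputs, \[ \Pr\Big[\forall i\in[n],\,j\in[q]:\ (1-\epsilon)\|x_i-y_j\|\le E(i,j)\le(1+\epsilon)\|x_i-y_j\|\Big]\ge 1-\delta , \] where $\|\cdot\|$ is the Euclidean norm and the parameters $n,q,d,\Phi,\epsilon,\delta$ are known to both parties. Theorem. For the all-cross-distances problem there is a sketch of size \[ O\left(\frac{n}{\epsilon^2}\left(\log n\cdot\log(1/\epsilon)+\log(d\Phi)\log\left(\frac q\delta\right)\right)+\mathrm{poly}\big(d,\log\Phi,\log(q/\delta),\log(1/\epsilon)\big)\right)\ \text{bits.} \] Here $\epsilon$ and $\delta$ are bounded away from $1$: for any fixed constants $\epsilon_0,\delta_0<1$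 there are a constant $C>0$ and a real polynomial $P$ in four variables such that, for all $n,q,d,\Phi$ as above and all $0<\epsilon\le\epsilon_0$ and $0<\delta\le\delta_0$, the sketch always has at most \[ C\cdot\frac{n}{\epsilon^2}\left(\log n\cdot\log(1/\epsilon)+\log(d\Phi)\log\left(\frac q\delta\right)\right)+P\big(d,\log\Phi,\log(q/\delta),\log(1/\epsilon)\big) \] bits. -/

import Mathlib

/-- The points of the integer grid `{-Φ, …, Φ}^d`. -/
abbrev GridPoint (d Φ : ℕ) : Type :=
  Fin d → Set.Icc (-(Φ : ℤ)) (Φ : ℤ)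

/-- The Euclidean distance between two grid points, both regarded as vectors of `ℝ^d`. -/
noncomputable def gridDist {d Φ : ℕ} (x y : GridPoint d Φ) : ℝ :=
  dist (WithLp.toLp 2 (fun k => ((x k : ℤ) : ℝ)) : EuclideanSpace ℝ (Fin d))
    (WithLp.toLp 2 (fun k => ((y k : ℤ) : ℝ)))

/-- A one-way communication protocol with private randomness, with a message of `b` bits.
Alice holds `n` data points and sends a random `b`-bit string (the sketch) computed from them;
Bob holds `q` query points and, from the sketch and his points only (and fresh coins of his own),
reports a table of `n * q` real numbers. -/
structure OneWayProtocol (n q d Φ b : ℕ) where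
  /-- The distribution of Alice's message, as a function of her data points. -/
  sketch : (Fin n → GridPoint d Φ) → PMF (Fin b → Bool)
  /-- The distribution of Bob's output, as a function of the message and his query points. -/
  report : (Fin b → Bool) → (Fin q → GridPoint d Φ) → PMF (Fin n → Fin q → ℝ)

/-- The distribution of the output of the protocol on the data points `x` and the queries `y`.
The coins of the two parties are independent. -/
noncomputable def OneWayProtocol.output {n q d Φ b : ℕ} (π : OneWayProtocol n q d Φ b)
    (x : Fin n → GridPoint d Φ) (y : Fin q → GridPoint d Φ) : PMF (Fin n → Fin q → ℝ) :=
  (π.sketch x).bind (fun s => π.report s y)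

/-- The tables that estimate all the cross-distances up to distortion `1 ± ε`. -/
def GoodEstimates {n q d Φ : ℕ} (ε : ℝ) (x : Fin n → GridPoint d Φ)
    (y : Fin q → GridPoint d Φ) : Set (Fin n → Fin q → ℝ) :=
  {E | ∀ i j, (1 - ε) * gridDist (x i) (y j) ≤ E i j ∧
    E i j ≤ (1 + ε) * gridDist (x i) (y j)}

/-- The protocol solves the all-cross-distances problem: for all data points and all queries, with
probability at least `1 - δ`, all the estimates are correct simultaneously. -/
def OneWayProtocol.SolvesAllCrossDistances {n q d Φ b : ℕ} (π : OneWayProtocol n q d Φ b)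
    (ε δ : ℝ) : Prop :=
  ∀ (x : Fin n → GridPoint d Φ) (y : Fin q → GridPoint d Φ),
    ENNReal.ofReal (1 - δ) ≤ (π.output x y).toOuterMeasure (GoodEstimates ε x y)

/-! For a standard Gaussian `g`, the mean of `cos(⟨g, z⟩ / σ)` is `exp(-‖z‖² / (2σ²))`, which
determines `‖z‖` stably when `‖z‖ / σ` is of constant order. So about `ε⁻²` samples give a `1 ± ε`
estimate of `‖x - y‖`. Bob needs `⟨g, x⟩` only up to a small rounding error and modulo the period of
the coarsest scale in use: distances in a range of ratio `2 ^ V` cost `W + V` bits per sample, with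
`2 ^ (-W)` of order `ε`.

Coding every point over the full range with failure probability `δ / (nq)` would cost a term `log n
· log(dΦ)`. This is avoided by two codes.

The first code has high confidence and short range. Distances are cut into levels of ratio `B = 2 ^
W`. At level `l`, data points are replaced by points of a net of resolution `B ^ l / B`, a small
fraction of every distance of that level. A net point is coded only if it is active, that is, linked
at threshold `2 * B ^ (l + 1)` to another net point. Alice sends a minimum spanning tree with exact
edge lengths, from which Bob computes nets and active points. A total variation argument along the
tree (`card_activeNet_mul_le`), summed geometrically over the levels (`sum_card_activeNet_le`),
bounds the active points of all levels together by `64 n`.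

The second code has low confidence and full range, for every data point. A point is silent for `y`
if no level yields an estimate. If `x i` is silent, its representative at the level of `‖x i - y‖`
is inactive, so each point at least as close to `y` has the same representative
(`sub_le_of_silent`). Hence all silent points are at nearly the same distance from `y`, and one
reading of the second code serves them all. The choice of that point depends on the first samples
only, so the second, independent samples need a union bound over the `q` queries alone. To keep the
number of scales out of this bound, the estimator uses the coarsest admissible scale, and one
truncated second moment controls all coarser scales (`exists_seeds_accurateNear`).

Randomness is private, so the samples come from fixed finite families of seeds that are good for
most indices at every pair of grid points (`exists_seeds`); Alice sends random indices. If `n` is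
small, or `d < 1 / ε²`, sending the points themselves is cheap enough; otherwise `log(1/ε) ≤
log(dΦ)`, which absorbs the remaining cross term. -/

open MeasureTheory ProbabilityTheory

/-! ### Concentration and finite families of seeds -/

/-- Hoeffding's inequality for the mean of `k` independent samples of a `[-1, 1]`-valued function. -/
theorem measureReal_pi_abs_mean_sub_integral_ge_le {Ω : Type*} [MeasurableSpace Ω]
    (μ : Measure Ω) [IsProbabilityMeasure μ] {f : Ω → ℝ} (hf : Measurable f)
    (hb : ∀ ω, f ω ∈ Set.Icc (-1 : ℝ) 1) {k : ℕ} (hk : 0 < k) {ε : ℝ} (hε : 0 ≤ ε) :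
    (Measure.pi fun _ : Fin k => μ).real {ω | ε ≤ |(∑ t, f (ω t)) / k - ∫ x, f x ∂μ|}
      ≤ 2 * Real.exp (-(k * ε ^ 2 / 2)) := by
  have one_sided : ∀ g : Ω → ℝ, Measurable g → (∀ ω, g ω ∈ Set.Icc (-1 : ℝ) 1) →
      (Measure.pi fun _ : Fin k => μ).real {ω | ε ≤ (∑ t, g (ω t)) / k - ∫ x, g x ∂μ}
        ≤ Real.exp (-(k * ε ^ 2 / 2)) := by
    intro g hg hgb
    have hsub : HasSubgaussianMGF (fun x => g x - ∫ x, g x ∂μ) 1 μ := by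
      have := hasSubgaussianMGF_of_mem_Icc (μ := μ) hg.aemeasurable (ae_of_all _ hgb)
      convert this
      norm_num
    have hind : iIndepFun (fun (t : Fin k) (ω : Fin k → Ω) => g (ω t) - ∫ x, g x ∂μ)
        (Measure.pi fun _ : Fin k => μ) :=
      iIndepFun_pi (μ := fun _ : Fin k => μ) (X := fun _ x => g x - ∫ x, g x ∂μ)
        (fun _ => (hg.sub_const _).aemeasurable)
    have hsubt : ∀ t ∈ (Finset.univ : Finset (Fin k)),
        HasSubgaussianMGF (fun ω : Fin k → Ω => g (ω t) - ∫ x, g x ∂μ) 1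
          (Measure.pi fun _ : Fin k => μ) := by
      intro t _
      have hm : (Measure.pi fun _ : Fin k => μ).map (fun ω => ω t) = μ :=
        (measurePreserving_eval (fun _ : Fin k => μ) t).map_eq
      exact HasSubgaussianMGF.of_map (X := fun x => g x - ∫ x, g x ∂μ)
        (measurable_pi_apply t).aemeasurable (by rw [hm]; exact hsub)
    have h := HasSubgaussianMGF.measure_sum_ge_le_of_iIndepFun hind hsubt
      (ε := k * ε) (by positivity)
    have hk' : (0 : ℝ) < k := by exact_mod_cast hk
    have hset : {ω : Fin k → Ω | ε ≤ (∑ t, g (ω t)) / k - ∫ x, g x ∂μ}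
        = {ω | (k : ℝ) * ε ≤ ∑ t, (g (ω t) - ∫ x, g x ∂μ)} := by
      ext ω
      simp only [Set.mem_ofPred_eq, Finset.sum_sub_distrib, Finset.sum_const, Finset.card_univ,
        Fintype.card_fin, nsmul_eq_mul]
      rw [le_sub_iff_add_le, le_div_iff₀ hk', le_sub_iff_add_le]
      constructor <;> intro h <;> linarith
    rw [hset]
    refine h.trans (le_of_eq ?_)
    congr 1
    simp
    field_simp
  have h1 := one_sided f hf hb
  have h2 := one_sided (fun x => - f x) hf.neg
    (fun ω => ⟨by linarith [(hb ω).2], by linarith [(hb ω).1]⟩)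
  have hsub : {ω : Fin k → Ω | ε ≤ |(∑ t, f (ω t)) / k - ∫ x, f x ∂μ|} ⊆
      {ω | ε ≤ (∑ t, f (ω t)) / k - ∫ x, f x ∂μ} ∪
      {ω | ε ≤ (∑ t, -f (ω t)) / k - ∫ x, -f x ∂μ} := by
    intro ω hω
    rcases le_abs.1 (show ε ≤ |_| from hω) with h | h
    · exact Or.inl h
    · right
      simp only [Set.mem_ofPred_eq, Finset.sum_neg_distrib, integral_neg, neg_div]
      linarith
  calc _ ≤ _ := measureReal_mono hsub
    _ ≤ _ := measureReal_union_le _ _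
    _ ≤ _ := by linarith

/-- Finitely many seeds, each consisting of `k` sample points, such that for every `z` all but a
fraction `η` of the seeds estimate the means of all the functions `f z i` up to `ε`. -/
theorem exists_seeds {Ω Z I : Type*} [MeasurableSpace Ω] [Fintype Z] [Fintype I]
    (μ : Measure Ω) [IsProbabilityMeasure μ] (f : Z → I → Ω → ℝ)
    (hf : ∀ z i, Measurable (f z i)) (hb : ∀ z i ω, f z i ω ∈ Set.Icc (-1 : ℝ) 1)
    {k t : ℕ} (hk : 0 < k) (ht : 0 < t) {ε η : ℝ} (hε : 0 ≤ ε) (hη : 0 < η)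
    (hkη : 2 * (Fintype.card I : ℝ) * Real.exp (-(k * ε ^ 2 / 2)) ≤ η / 2)
    (htη : 2 * (Fintype.card Z : ℝ) * Real.exp (-(t * (η / 2) ^ 2 / 2)) < 1) :
    ∃ G : Fin t → Fin k → Ω, ∀ z,
      (Nat.card {a : Fin t // ∃ i, ε ≤ |(∑ j, f z i (G a j)) / k - ∫ x, f z i x ∂μ|} : ℝ)
        ≤ η * t := by
  classical
  set ν := Measure.pi fun _ : Fin k => μ
  set bad : Z → Set (Fin k → Ω) := fun z =>
    {ω | ∃ i, ε ≤ |(∑ j, f z i (ω j)) / k - ∫ x, f z i x ∂μ|}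
  have hbad : ∀ z, MeasurableSet (bad z) := by
    intro z
    have : bad z = ⋃ i, {ω : Fin k → Ω | ε ≤ |(∑ j, f z i (ω j)) / k - ∫ x, f z i x ∂μ|} := by
      ext; simp [bad]
    rw [this]
    refine MeasurableSet.iUnion fun i => measurableSet_le measurable_const ?_
    have : Measurable fun ω : Fin k → Ω => ∑ j, f z i (ω j) :=
      Finset.measurable_sum _ fun j _ => (hf z i).comp (measurable_pi_apply j)
    exact ((this.div_const _).sub_const _).abs
  have hbadm : ∀ z, ν.real (bad z) ≤ η / 2 := by
    intro z
    have : bad z = ⋃ i, {ω : Fin k → Ω | ε ≤ |(∑ j, f z i (ω j)) / k - ∫ x, f z i x ∂μ|} := by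
      ext; simp [bad]
    rw [this]
    refine (measureReal_iUnion_fintype_le _).trans ?_
    refine (Finset.sum_le_sum fun i _ =>
      measureReal_pi_abs_mean_sub_integral_ge_le μ (hf z i) (hb z i) hk hε).trans ?_
    simp only [Finset.sum_const, Finset.card_univ, nsmul_eq_mul]
    linarith
  -- A random seed is bad for `z` with probability at most `η / 2`. Hoeffding's inequality for the
  -- indicator of badness, now over the `t` seeds, loses another `η / 2`; a union bound over `z`
  -- leaves a family that is good for all `z`.
  set g : Z → (Fin k → Ω) → ℝ := fun z => (bad z).indicator 1
  have hg : ∀ z, Measurable (g z) := fun z => measurable_one.indicator (hbad z)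
  have hgb : ∀ z ω, g z ω ∈ Set.Icc (-1 : ℝ) 1 := by
    intro z ω
    by_cases h : ω ∈ bad z <;> simp [g, h]
  have hgi : ∀ z, ∫ x, g z x ∂ν = ν.real (bad z) := fun z => integral_indicator_one (hbad z)
  set worse : Z → Set (Fin t → Fin k → Ω) := fun z =>
    {ω | η / 2 ≤ |(∑ a, g z (ω a)) / t - ∫ x, g z x ∂ν|}
  have hworse : (Measure.pi fun _ : Fin t => ν).real (⋃ z, worse z) < 1 := by
    refine (measureReal_iUnion_fintype_le _).trans_lt ?_
    refine (Finset.sum_le_sum fun z _ =>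
      measureReal_pi_abs_mean_sub_integral_ge_le ν (hg z) (hgb z) ht (by positivity)).trans_lt ?_
    simp only [Finset.sum_const, Finset.card_univ, nsmul_eq_mul]
    linarith
  obtain ⟨G, hG⟩ : ∃ G, G ∉ ⋃ z, worse z := by
    by_contra! h
    rw [Set.eq_univ_of_forall h] at hworse
    simp at hworse
  refine ⟨G, fun z => ?_⟩
  have hz : |(∑ a, g z (G a)) / t - ∫ x, g z x ∂ν| < η / 2 := by
    by_contra! h
    exact hG (Set.mem_iUnion.2 ⟨z, h⟩)
  have ht' : (0 : ℝ) < t := by exact_mod_cast ht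
  have hcard : (Nat.card {a : Fin t // ∃ i, ε ≤ |(∑ j, f z i (G a j)) / k - ∫ x, f z i x ∂μ|} : ℝ)
      = ∑ a, g z (G a) := by
    rw [Nat.card_eq_fintype_card, Fintype.card_subtype]
    simp only [g, Set.indicator_apply, bad, Set.mem_ofPred_eq, Pi.one_apply]
    rw [Finset.sum_boole]
  rw [hcard]
  have := (abs_lt.1 hz).2
  rw [hgi] at this
  have h2 := hbadm z
  rw [← div_le_iff₀ ht']
  linarith

/-! ### Gaussian integrals -/

theorem integral_cos_inner_stdGaussian {E : Type*} [NormedAddCommGroup E] [InnerProductSpace ℝ E]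
    [FiniteDimensional ℝ E] [MeasurableSpace E] [BorelSpace E] (z : E) :
    ∫ x, Real.cos (inner ℝ x z) ∂(stdGaussian E) = Real.exp (-‖z‖ ^ 2 / 2) := by
  have h := charFun_stdGaussian (E := E) z
  rw [charFun_apply] at h
  have hre := congrArg Complex.re h
  have hint : Integrable (fun x : E => Complex.exp ((inner ℝ x z : ℝ) * Complex.I))
      (stdGaussian E) := by
    refine Integrable.of_bound (C := 1) (by fun_prop) (ae_of_all _ fun x => ?_)
    rw [Complex.norm_exp_ofReal_mul_I]
  have hexp : Complex.exp (-(‖z‖ : ℂ) ^ 2 / 2) = ((Real.exp (-‖z‖ ^ 2 / 2) : ℝ) : ℂ) := by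
    push_cast; rfl
  rw [hexp, Complex.ofReal_re, ← RCLike.re_eq_complex_re, ← integral_re hint] at hre
  rw [← hre]
  simp [Complex.exp_ofReal_mul_I_re]

/-- The truncation at one makes the square a bounded statistic, to which Hoeffding's inequality
applies. -/
theorem integral_min_one_sq_inner_stdGaussian_le {E : Type*} [NormedAddCommGroup E]
    [InnerProductSpace ℝ E] [FiniteDimensional ℝ E] [MeasurableSpace E] [BorelSpace E] (z : E) :
    ∫ x, min 1 (inner ℝ x z ^ 2) ∂(stdGaussian E) ≤ ‖z‖ ^ 2 := by
  have hvar := variance_dual_stdGaussian (E := E) (innerSL ℝ z)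
  have hmean := integral_strongDual_stdGaussian (E := E) (innerSL ℝ z)
  have hL2 : MemLp (innerSL ℝ z) 2 (stdGaussian E) := by
    exact IsGaussian.memLp_dual _ _ _ (by simp)
  rw [variance_of_integral_eq_zero (by fun_prop) hmean, innerSL_apply_norm] at hvar
  rw [← hvar]
  refine integral_mono_of_nonneg (ae_of_all _ fun x => by positivity) hL2.integrable_sq
    (ae_of_all _ fun x => ?_)
  simp only [innerSL_apply_apply]
  rw [real_inner_comm]
  exact min_le_right _ _

/-! ### Minimum spanning forests -/

/-- The graph on `V` whose edges are the pairs at distance at most `s`. -/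
def thresholdGraph {V : Type*} (D : V → V → ℝ) (hD : ∀ u v, D u v = D v u) (s : ℝ) :
    SimpleGraph V where
  Adj u v := u ≠ v ∧ D u v ≤ s
  symm := ⟨fun u v h => ⟨h.1.symm, hD u v ▸ h.2⟩⟩
  loopless := ⟨fun _ h => h.1 rfl⟩

/-- Kruskal's algorithm: the thresholds are treated in increasing order, and at each one the forest
is extended to span the components of the threshold graph. Edges added later do not affect
connectivity at earlier thresholds. -/
theorem exists_isAcyclic_reachable_inf_thresholdGraph {V : Type*} [Finite V] (D : V → V → ℝ)
    (hD : ∀ u v, D u v = D v u) (S : Finset ℝ) :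
    ∃ F : SimpleGraph V, F.IsAcyclic ∧ (∀ a, (∀ s ∈ S, s ≤ a) → F ≤ thresholdGraph D hD a) ∧
      ∀ s ∈ S, ∀ u v, (thresholdGraph D hD s).Reachable u v →
        (F ⊓ thresholdGraph D hD s).Reachable u v := by
  have hmono : ∀ {a b : ℝ}, a ≤ b → thresholdGraph D hD a ≤ thresholdGraph D hD b :=
    fun hab u v h => ⟨h.1, h.2.trans hab⟩
  induction S using Finset.induction_on_max with
  | empty => exact ⟨⊥, SimpleGraph.isAcyclic_bot, by simp, by simp⟩
  | insert a S ha ih =>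
    obtain ⟨F, hF, hle, hreach⟩ := ih
    obtain ⟨F', hFF', hF'a, hF', hr⟩ :=
      SimpleGraph.exists_isAcyclic_reachable_eq_le_of_le_of_isAcyclic
        (hle a fun s hs => (ha s hs).le) hF
    refine ⟨F', hF', fun b hb => hF'a.trans (hmono (hb a (by simp))), fun s hs u v huv => ?_⟩
    rcases Finset.mem_insert.1 hs with rfl | hs
    · rw [inf_eq_left.2 hF'a, hr]
      exact huv
    · exact (hreach s hs u v huv).mono (inf_le_inf_right _ hFF')

theorem SimpleGraph.IsAcyclic.card_edgeSet_le {V : Type*} [Finite V] {F : SimpleGraph V}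
    (hF : F.IsAcyclic) : Nat.card F.edgeSet ≤ Nat.card V := by
  classical
  rcases isEmpty_or_nonempty V with h | h
  · have : IsEmpty F.edgeSet := ⟨fun e => by
      obtain ⟨e, he⟩ := e
      induction e with | _ x y => exact h.elim x⟩
    simp
  obtain ⟨T, hFT, -, hT⟩ :=
    (SimpleGraph.connected_top (V := V)).exists_isTree_le_of_le_of_isAcyclic le_top hF
  have h1 := (SimpleGraph.isTree_iff_connected_and_card.1 hT).2
  have h2 : Nat.card F.edgeSet ≤ Nat.card T.edgeSet :=
    Nat.card_mono (Set.toFinite _) (SimpleGraph.edgeSet_mono hFT)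
  omega

/-- A minimum spanning tree, given by the list of its edges (possibly padded by loops): any two
vertices are connected by edges that are not longer than their distance. -/
theorem exists_bottleneck_edges {n : ℕ} (D : Fin n → Fin n → ℝ)
    (hD : ∀ u v, D u v = D v u) :
    ∃ e : Fin n → Fin n × Fin n, ∀ u v s, D u v ≤ s →
      Relation.EqvGen (fun x y => ∃ m, D (e m).1 (e m).2 ≤ s ∧ e m = (x, y)) u v := by
  classical
  obtain ⟨F, hF, -, hreach⟩ := exists_isAcyclic_reachable_inf_thresholdGraph D hD
    (Finset.univ.image fun p : Fin n × Fin n => D p.1 p.2)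
  have hcard : Fintype.card F.edgeSet ≤ Fintype.card (Fin n) := by
    have := hF.card_edgeSet_le
    rwa [Nat.card_eq_fintype_card, Nat.card_eq_fintype_card] at this
  obtain ⟨φ⟩ := Function.Embedding.nonempty_of_card_le hcard
  refine ⟨fun m => if h : ∃ x : F.edgeSet, φ x = m then Quot.out h.choose.1 else (m, m),
    fun u v s huv => ?_⟩
  have hedge : ∀ x : F.edgeSet, ∃ m, (if h : ∃ x : F.edgeSet, φ x = m then
      Quot.out h.choose.1 else (m, m)) = Quot.out x.1 := by
    intro x
    refine ⟨φ x, ?_⟩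
    have h : ∃ x' : F.edgeSet, φ x' = φ x := ⟨x, rfl⟩
    rw [dif_pos h, φ.injective h.choose_spec]
  have hr : (F ⊓ thresholdGraph D hD (D u v)).Reachable u v := by
    by_cases h : u = v
    · subst h; rfl
    exact hreach (D u v) (Finset.mem_image_of_mem (fun p : Fin n × Fin n => D p.1 p.2)
      (Finset.mem_univ (u, v))) u v (SimpleGraph.Adj.reachable ⟨h, le_rfl⟩)
  obtain ⟨p⟩ := hr
  have key : ∀ {a b : Fin n}, (F ⊓ thresholdGraph D hD (D u v)).Walk a b →
      Relation.EqvGen (fun x y => ∃ m, D ((fun m => if h : ∃ x : F.edgeSet, φ x = m then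
      Quot.out h.choose.1 else (m, m)) m).1 ((fun m => if h : ∃ x : F.edgeSet, φ x = m then
      Quot.out h.choose.1 else (m, m)) m).2 ≤ s ∧ (fun m => if h : ∃ x : F.edgeSet, φ x = m then
      Quot.out h.choose.1 else (m, m)) m = (x, y)) a b := by
    intro a b p
    induction p with
    | nil => exact .refl _
    | @cons a b c hab _ ih =>
      refine .trans _ _ _ ?_ ih
      obtain ⟨m, hm⟩ := hedge ⟨s(a, b), hab.1⟩
      have hout : s((Quot.out s(a, b)).1, (Quot.out s(a, b)).2) = s(a, b) := Quot.out_eq _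
      have hle : D a b ≤ s := hab.2.2.trans huv
      rcases Sym2.eq_iff.1 hout with ⟨h1, h2⟩ | ⟨h1, h2⟩
      · refine .rel _ _ ⟨m, ?_, ?_⟩
        · simp only [hm, h1, h2]; exact hle
        · simp only [hm]; exact Prod.ext h1 h2
      · refine .symm _ _ (.rel _ _ ⟨m, ?_, ?_⟩)
        · simp only [hm, h1, h2]; rw [hD]; exact hle
        · simp only [hm]; exact Prod.ext h1 h2
  exact key p

/-! ### Recovering a distance from Gaussian kernel values -/

/-- On `[1/2, 3]` the kernel is at least `exp (-5) ≥ 1 / 200` and its exponent has slope bounded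
away from zero, so the kernel can be inverted with a constant loss. -/
theorem abs_sub_le_of_abs_exp_neg_sq_sub_le {u u' κ : ℝ} (hu : 1 / 2 ≤ u) (hu3 : u ≤ 3)
    (hu' : 0 ≤ u') (h : |Real.exp (-u ^ 2 / 2) - Real.exp (-u' ^ 2 / 2)| ≤ κ)
    (hκ : κ ≤ 1 / 1000) : |u - u'| ≤ 800 * κ := by
  have hp : 1 / 200 ≤ Real.exp (-u ^ 2 / 2) := by
    have h5 : Real.exp 5 ≤ 200 := by
      have : Real.exp 5 = Real.exp 1 ^ 5 := by rw [← Real.exp_nat_mul]; norm_num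
      rw [this]
      calc Real.exp 1 ^ 5 ≤ 2.7182818286 ^ 5 := by
            gcongr; exact Real.exp_one_lt_d9.le
        _ ≤ 200 := by norm_num
    have : Real.exp (-5) ≤ Real.exp (-u ^ 2 / 2) := Real.exp_le_exp.2 (by nlinarith)
    rw [Real.exp_neg] at this
    refine le_trans ?_ this
    rw [one_div]
    exact inv_anti₀ (Real.exp_pos _) h5
  rcases le_total u' u with hle | hle
  · have he : Real.exp (-u' ^ 2 / 2)
        = Real.exp (-u ^ 2 / 2) * Real.exp ((u ^ 2 - u' ^ 2) / 2) := by
      rw [← Real.exp_add]; ring_nf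
    have ht := Real.add_one_le_exp ((u ^ 2 - u' ^ 2) / 2)
    have h1 : (u - u') / 4 ≤ (u ^ 2 - u' ^ 2) / 2 := by nlinarith
    have h2 := (abs_le.1 h).1
    rw [abs_of_nonneg (by linarith)]
    nlinarith
  · have he : Real.exp (-u' ^ 2 / 2)
        = Real.exp (-u ^ 2 / 2) * Real.exp (-((u' ^ 2 - u ^ 2) / 2)) := by
      rw [← Real.exp_add]; ring_nf
    set t := (u' ^ 2 - u ^ 2) / 2 with ht
    have h1 : (u' - u) / 2 ≤ t := by rw [ht]; nlinarith
    have ht0 : 0 ≤ t := by linarith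
    have h2 := (abs_le.1 h).2
    have hq : Real.exp (-t) * (1 + t) ≤ 1 := by
      have := Real.add_one_le_exp t
      calc Real.exp (-t) * (1 + t) ≤ Real.exp (-t) * Real.exp t := by gcongr; linarith
        _ = 1 := by rw [← Real.exp_add]; simp
    have hq1 : 1 - Real.exp (-t) ≤ 200 * κ := by
      have : 0 ≤ 1 - Real.exp (-t) := by
        have := Real.exp_le_one_iff.2 (neg_nonpos.2 ht0)
        linarith
      nlinarith
    rw [abs_of_nonpos (by linarith)]
    nlinarith

/-- The distance `e` is compatible with the value `v` observed at the scale `σ`. -/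
def Admissible (κ σ v e : ℝ) : Prop :=
  1 / 2 ≤ e / σ ∧ e / σ ≤ 3 ∧ |Real.exp (-(e / σ) ^ 2 / 2) - v| ≤ 2 * κ

/-- The distance `e` is admissible at the coarsest scale with an admissible distance. -/
def TopAdmissible (κ s : ℝ) (V : ℕ) (v : ℕ → ℝ) (e : ℝ) : Prop :=
  ∃ i < V, Admissible κ (s * 2 ^ i) (v i) e ∧
    ∀ i', i < i' → i' < V → ∀ e', ¬ Admissible κ (s * 2 ^ i') (v i') e'

open Classical in
/-- The distance recovered from the values observed at the scales `s * 2 ^ i`, `i < V`. -/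
noncomputable def estimate (κ s : ℝ) (V : ℕ) (v : ℕ → ℝ) : Option ℝ :=
  if h : ∃ e, TopAdmissible κ s V v e then some h.choose else none

theorem topAdmissible_of_estimate {κ s : ℝ} {V : ℕ} {v : ℕ → ℝ} {e : ℝ}
    (h : estimate κ s V v = some e) : TopAdmissible κ s V v e := by
  unfold estimate at h
  split_ifs at h with h'
  rw [← Option.some.inj h]
  exact h'.choose_spec

theorem exists_estimate_eq_some {κ s : ℝ} {V : ℕ} {v : ℕ → ℝ} {i : ℕ} {e : ℝ} (hi : i < V)
    (h : Admissible κ (s * 2 ^ i) (v i) e) : ∃ e', estimate κ s V v = some e' := by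
  classical
  have hex : ∃ e, TopAdmissible κ s V v e := by
    let S := (Finset.range V).filter fun i => ∃ e, Admissible κ (s * 2 ^ i) (v i) e
    have hS : S.Nonempty := ⟨i, by simp only [S, Finset.mem_filter, Finset.mem_range]; exact ⟨hi, e, h⟩⟩
    have hmem := S.max'_mem hS
    simp only [S, Finset.mem_filter, Finset.mem_range] at hmem
    obtain ⟨hlt, e', he'⟩ := hmem
    refine ⟨e', _, hlt, he', fun i' hi' hi'V e'' he'' => ?_⟩
    have : i' ≤ S.max' hS := S.le_max' _ (by
      simp only [S, Finset.mem_filter, Finset.mem_range]; exact ⟨hi'V, e'', he''⟩)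
    exact absurd hi' (not_lt.2 this)
  exact ⟨hex.choose, dif_pos hex⟩

/-- The kernel values of `e` and `D` are both within `2 * κ` of `v`. Inversion gives `3200 * κ * σ`,
and `σ ≤ 2 * e` turns this into a relative error. -/
theorem Admissible.abs_sub_le {κ σ v e D : ℝ} (h : Admissible κ σ v e) (hσ : 0 < σ)
    (hκ : κ ≤ 1 / 4000) (hD : 0 ≤ D) (hv : |v - Real.exp (-(D / σ) ^ 2 / 2)| ≤ 2 * κ) :
    |e - D| ≤ 6400 * κ * e ∧ σ / 2 ≤ e := by
  obtain ⟨h1, h2, h3⟩ := h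
  have hκ0 : 0 ≤ κ := by linarith [abs_nonneg (v - Real.exp (-(D / σ) ^ 2 / 2))]
  have h4 : |e / σ - D / σ| ≤ 800 * (4 * κ) := by
    refine abs_sub_le_of_abs_exp_neg_sq_sub_le h1 h2 (by positivity) ?_ (by linarith)
    calc _ ≤ |Real.exp (-(e / σ) ^ 2 / 2) - v| + |v - Real.exp (-(D / σ) ^ 2 / 2)| :=
          _root_.abs_sub_le _ _ _
      _ ≤ _ := by linarith
  have he : σ / 2 ≤ e := by rw [le_div_iff₀ hσ] at h1; linarith
  refine ⟨?_, he⟩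
  rw [← sub_div, abs_div, abs_of_pos hσ, div_le_iff₀ hσ] at h4
  nlinarith

/-- An admissible distance is at least half the scale, so its kernel value is at most `exp (-1/8) ≤
8 / 9`, too far below `19 / 20`. -/
theorem not_admissible_of_le {κ σ v e : ℝ} (hκ : κ ≤ 1 / 4000) (hv : 19 / 20 ≤ v) :
    ¬ Admissible κ σ v e := by
  rintro ⟨h1, -, h3⟩
  have h4 : Real.exp (-(e / σ) ^ 2 / 2) ≤ 8 / 9 := by
    calc Real.exp (-(e / σ) ^ 2 / 2) ≤ Real.exp (-(1 / 8)) := Real.exp_le_exp.2 (by nlinarith)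
      _ = (Real.exp (1 / 8))⁻¹ := Real.exp_neg _
      _ ≤ (9 / 8 : ℝ)⁻¹ := by
        refine inv_anti₀ (by norm_num) ?_
        linarith [Real.add_one_le_exp (1 / 8 : ℝ)]
      _ = 8 / 9 := by norm_num
  have := (abs_le.1 h3).1
  linarith

/-- If the observed values are accurate at all scales, so is the estimate. -/
theorem abs_sub_le_of_estimate {κ s D e : ℝ} {V : ℕ} {v : ℕ → ℝ} (hs : 0 < s)
    (hκ : κ ≤ 1 / 4000) (hD : 0 ≤ D)
    (hv : ∀ i < V, |v i - Real.exp (-(D / (s * 2 ^ i)) ^ 2 / 2)| ≤ 2 * κ)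
    (h : estimate κ s V v = some e) : |e - D| ≤ 6400 * κ * e ∧ s / 2 ≤ e := by
  obtain ⟨i, hi, ha, -⟩ := topAdmissible_of_estimate h
  have := ha.abs_sub_le (by positivity) hκ hD (hv i hi)
  refine ⟨this.1, le_trans ?_ this.2⟩
  have : (1 : ℝ) ≤ 2 ^ i := one_le_pow₀ (by norm_num)
  nlinarith

theorem estimate_eq_none_of_le {κ s : ℝ} {V : ℕ} {v : ℕ → ℝ} (hκ : κ ≤ 1 / 4000)
    (hv : ∀ i < V, 19 / 20 ≤ v i) : estimate κ s V v = none := by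
  by_contra h
  obtain ⟨e, he⟩ := Option.ne_none_iff_exists'.1 h
  obtain ⟨i, hi, ha, -⟩ := topAdmissible_of_estimate he
  exact not_admissible_of_le hκ (hv i hi) ha

/-- For an accurate estimate it is enough that the observed values are accurate at the three scales
next to the distance, and close to one at coarser scales. -/
theorem exists_estimate_of_accurate_near {κ s D : ℝ} {V i₀ : ℕ} {v : ℕ → ℝ} (hs : 0 < s)
    (hκ : κ ≤ 1 / 4000) (hi₀ : i₀ < V) (hD1 : s * 2 ^ i₀ ≤ D) (hD2 : D < s * 2 ^ (i₀ + 1))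
    (hv : ∀ i < V, i₀ ≤ i → i < i₀ + 3 → |v i - Real.exp (-(D / (s * 2 ^ i)) ^ 2 / 2)| ≤ 2 * κ)
    (hv' : ∀ i < V, i₀ + 3 ≤ i → 19 / 20 ≤ v i) :
    ∃ e, estimate κ s V v = some e ∧ |e - D| ≤ 6400 * κ * e := by
  have hs0 : 0 < s * 2 ^ i₀ := by positivity
  -- The true distance is admissible at `i₀`, so the coarsest admissible scale is at least `i₀`;
  -- values near one exclude scales from `i₀ + 3` on. The values at finer scales, which may be
  -- wrong, play no role.
  have hadm : Admissible κ (s * 2 ^ i₀) (v i₀) D := by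
    refine ⟨?_, ?_, ?_⟩
    · rw [le_div_iff₀ hs0]; linarith
    · rw [div_le_iff₀ hs0]; rw [pow_succ] at hD2; linarith
    · rw [abs_sub_comm]; exact hv i₀ hi₀ le_rfl (by omega)
  obtain ⟨e, he⟩ := exists_estimate_eq_some hi₀ hadm
  refine ⟨e, he, ?_⟩
  obtain ⟨i, hi, ha, htop⟩ := topAdmissible_of_estimate he
  have h1 : i₀ ≤ i := by
    by_contra! hlt
    exact htop i₀ hlt hi₀ D hadm
  have h2 : i < i₀ + 3 := by
    by_contra! hge
    exact not_admissible_of_le hκ (hv' i hi hge) ha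
  exact (ha.abs_sub_le (by positivity) hκ (hs0.le.trans hD1) (hv i hi h1 h2)).1

/-! ### Modular encoding of angles -/

/-- The angle `θ`, rounded down to a multiple of `2 * π * s / 2 ^ W` and reduced modulo
`2 * π * s * 2 ^ V`. -/
noncomputable def encodeAngle (s : ℝ) (W V : ℕ) (θ : ℝ) : Fin (2 ^ (W + V)) :=
  ⟨(⌊θ * 2 ^ W / (2 * Real.pi * s)⌋ % (2 ^ (W + V) : ℕ)).toNat, by
    have h : (0 : ℤ) < (2 ^ (W + V) : ℕ) := by positivity
    have h1 := Int.emod_nonneg ⌊θ * 2 ^ W / (2 * Real.pi * s)⌋ h.ne'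
    have h2 := Int.emod_lt_of_pos ⌊θ * 2 ^ W / (2 * Real.pi * s)⌋ h
    omega⟩

/-- The mean of the cosines of the angles encoded by `c`, relative to the angles `β`, at the scale
`s * 2 ^ i`. -/
noncomputable def observed (s : ℝ) (W V : ℕ) {k : ℕ} (c : Fin k → Fin (2 ^ (W + V)))
    (β : Fin k → ℝ) (i : ℕ) : ℝ :=
  (∑ t, Real.cos (((c t : ℕ) * (2 * Real.pi * s) / 2 ^ W - β t) / (s * 2 ^ i))) / k

/-- For `i ≤ V` the period `2 * π * s * 2 ^ i` divides the modulus, so the reduction is invisible to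
the cosine. Only the rounding error counts, divided by a scale that is at least `s`. -/
theorem abs_cos_encodeAngle_sub_le {s : ℝ} (hs : 0 < s) (W V : ℕ) (θ β : ℝ) {i : ℕ} (hi : i ≤ V) :
    |Real.cos (((encodeAngle s W V θ : ℕ) * (2 * Real.pi * s) / 2 ^ W - β) / (s * 2 ^ i))
      - Real.cos ((θ - β) / (s * 2 ^ i))| ≤ 2 * Real.pi / 2 ^ W := by
  have hπ := Real.pi_pos
  set m : ℤ := ⌊θ * 2 ^ W / (2 * Real.pi * s)⌋ with hm
  have hN : (0 : ℤ) < (2 ^ (W + V) : ℕ) := by positivity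
  have henc : ((encodeAngle s W V θ : ℕ) : ℝ) = m - 2 ^ (W + V) * (m / (2 ^ (W + V) : ℕ) : ℤ) := by
    have h1 : ((encodeAngle s W V θ : ℕ) : ℤ) = m % (2 ^ (W + V) : ℕ) :=
      Int.toNat_of_nonneg (Int.emod_nonneg _ hN.ne')
    have h2 : ((encodeAngle s W V θ : ℕ) : ℤ) = m - (2 ^ (W + V) : ℕ) * (m / (2 ^ (W + V) : ℕ)) := by
      rw [h1, Int.emod_def]
    exact_mod_cast h2
  set q : ℤ := m / (2 ^ (W + V) : ℕ) with hq
  obtain ⟨j, rfl⟩ := Nat.exists_eq_add_of_le hi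
  have hangle : ((encodeAngle s W (i + j) θ : ℕ) * (2 * Real.pi * s) / 2 ^ W - β) / (s * 2 ^ i)
      = (m * (2 * Real.pi * s) / 2 ^ W - β) / (s * 2 ^ i) - ((q * 2 ^ j : ℤ) : ℝ) * (2 * Real.pi) := by
    rw [henc]
    push_cast
    field_simp
    ring
  rw [hangle, Real.cos_sub_int_mul_two_pi]
  refine (Real.abs_cos_sub_cos_le _ _).trans ?_
  have hlow := Int.floor_le (θ * 2 ^ W / (2 * Real.pi * s))
  have hup := Int.lt_floor_add_one (θ * 2 ^ W / (2 * Real.pi * s))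
  rw [← hm] at hlow hup
  rw [← sub_div, abs_div, abs_of_pos (by positivity : (0:ℝ) < s * 2 ^ i), div_le_iff₀ (by positivity)]
  rw [le_div_iff₀ (by positivity)] at hlow
  rw [div_lt_iff₀ (by positivity)] at hup
  have h2i : (1 : ℝ) ≤ 2 ^ i := one_le_pow₀ (by norm_num)
  have hW : (0 : ℝ) < 2 ^ W := by positivity
  have hA : (m : ℝ) * (2 * Real.pi * s) / 2 ^ W ≤ θ := by rw [div_le_iff₀ hW]; exact hlow
  have hB : θ ≤ (m : ℝ) * (2 * Real.pi * s) / 2 ^ W + 2 * Real.pi / 2 ^ W * s := by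
    have : (m : ℝ) * (2 * Real.pi * s) / 2 ^ W + 2 * Real.pi / 2 ^ W * s
      = (m + 1) * (2 * Real.pi * s) / 2 ^ W := by ring
    rw [this, le_div_iff₀ hW]; exact hup.le
  have hC : 2 * Real.pi / 2 ^ W * s ≤ 2 * Real.pi / 2 ^ W * (s * 2 ^ i) := by
    have : s ≤ s * 2 ^ i := by nlinarith
    gcongr
  rw [abs_le]
  constructor <;> linarith

theorem abs_observed_sub_le {s : ℝ} (hs : 0 < s) (W V : ℕ) {k : ℕ} (hk : 0 < k)
    (θ β : Fin k → ℝ) {i : ℕ} (hi : i ≤ V) :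
    |observed s W V (fun t => encodeAngle s W V (θ t)) β i
      - (∑ t, Real.cos ((θ t - β t) / (s * 2 ^ i))) / k| ≤ 2 * Real.pi / 2 ^ W := by
  have hk' : (0 : ℝ) < k := by exact_mod_cast hk
  unfold observed
  rw [← sub_div, ← Finset.sum_sub_distrib, abs_div, abs_of_pos hk', div_le_iff₀ hk']
  refine (Finset.abs_sum_le_sum_abs _ _).trans ?_
  refine (Finset.sum_le_sum fun t _ => abs_cos_encodeAngle_sub_le hs W V (θ t) (β t) hi).trans ?_
  simp [mul_comm]

/-! ### Nets in the capped path metric of a weighted graph -/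

section CappedDist

variable {V ι : Type*} (e : ι → V × V) (w : ι → ℝ)

/-- The functions with values in `[0, g]` that vary by at most `w m` along the edge `e m`. -/
def edgeLipschitz (g : ℝ) : Set (V → ℝ) :=
  {f | (∀ m, |f (e m).1 - f (e m).2| ≤ w m) ∧ ∀ v, 0 ≤ f v ∧ f v ≤ g}

/-- The shortest-path distance of the weighted graph with the edges `e m`, capped at `g`, in its
dual form. -/
noncomputable def cappedDist (g : ℝ) (u v : V) : ℝ :=
  sSup ((fun f : V → ℝ => f u - f v) '' edgeLipschitz e w g)

/-- Vertices are linked at threshold `τ` if edges of weight at most `τ` connect them. -/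
def Linked (τ : ℝ) : V → V → Prop :=
  Relation.EqvGen fun x y => ∃ m, w m ≤ τ ∧ e m = (x, y)

variable {e w} {g τ : ℝ} {u v x : V}

theorem le_cappedDist {f : V → ℝ} (hf : f ∈ edgeLipschitz e w g) :
    f u - f v ≤ cappedDist e w g u v := by
  refine le_csSup ⟨g, ?_⟩ ⟨f, hf, rfl⟩
  rintro _ ⟨f, hf, rfl⟩
  have h1 := hf.2 u
  have h2 := hf.2 v
  simp only
  linarith

theorem cappedDist_le {c : ℝ} (hc : 0 ≤ c) (h : ∀ f ∈ edgeLipschitz e w g, f u - f v ≤ c) :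
    cappedDist e w g u v ≤ c := by
  refine Real.sSup_le ?_ hc
  rintro _ ⟨f, hf, rfl⟩
  exact h f hf

theorem const_mem_edgeLipschitz (hw : ∀ m, 0 ≤ w m) (hg : 0 ≤ g) :
    (fun _ => 0) ∈ edgeLipschitz e w g :=
  ⟨fun m => by simpa using hw m, fun _ => ⟨le_rfl, hg⟩⟩

theorem cappedDist_nonneg (hw : ∀ m, 0 ≤ w m) (hg : 0 ≤ g) : 0 ≤ cappedDist e w g u v := by
  have := le_cappedDist (u := u) (v := v) (const_mem_edgeLipschitz (e := e) hw hg)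
  simpa using this

theorem cappedDist_self (u : V) : cappedDist e w g u u ≤ 0 :=
  cappedDist_le le_rfl fun f _ => by simp

theorem cappedDist_comm_le (hw : ∀ m, 0 ≤ w m) (hg : 0 ≤ g) :
    cappedDist e w g u v ≤ cappedDist e w g v u := by
  refine cappedDist_le (cappedDist_nonneg hw hg) fun f hf => ?_
  have hmem : (fun z => g - f z) ∈ edgeLipschitz e w g := by
    refine ⟨fun m => ?_, fun z => ?_⟩
    · have := hf.1 m
      rw [abs_sub_comm] at this
      simpa using this
    · have := hf.2 z
      constructor <;> linarith
  have := le_cappedDist (u := v) (v := u) hmem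
  linarith

theorem cappedDist_comm (hw : ∀ m, 0 ≤ w m) (hg : 0 ≤ g) :
    cappedDist e w g u v = cappedDist e w g v u :=
  le_antisymm (cappedDist_comm_le hw hg) (cappedDist_comm_le hw hg)

theorem cappedDist_triangle (hw : ∀ m, 0 ≤ w m) (hg : 0 ≤ g) :
    cappedDist e w g u x ≤ cappedDist e w g u v + cappedDist e w g v x := by
  refine cappedDist_le
    (add_nonneg (cappedDist_nonneg hw hg) (cappedDist_nonneg hw hg)) fun f hf => ?_
  have h1 := le_cappedDist (u := u) (v := v) hf
  have h2 := le_cappedDist (u := v) (v := x) hf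
  linarith

theorem cappedDist_edge_le (hw : ∀ m, 0 ≤ w m) (m : ι) :
    cappedDist e w g (e m).1 (e m).2 ≤ w m :=
  cappedDist_le (hw m) fun _ hf => (le_abs_self _).trans (hf.1 m)

/-- Below its cap, the capped distance dominates every distance along which the edges have length
at most their weight. -/
theorem dist_lt_of_cappedDist_lt {E : Type*} [PseudoMetricSpace E] (p : V → E)
    (hp : ∀ m, dist (p (e m).1) (p (e m).2) ≤ w m) (hg : 0 ≤ g)
    (h : cappedDist e w g u v < g) : dist (p u) (p v) < g := by
  have hmem : (fun z => min (dist (p z) (p v)) g) ∈ edgeLipschitz e w g := by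
    refine ⟨fun m => ?_, fun z => ⟨le_min dist_nonneg hg, min_le_right _ _⟩⟩
    refine (abs_min_sub_min_le_max _ _ _ _).trans ?_
    simp only [sub_self, abs_zero]
    exact max_le ((abs_dist_sub_le _ _ _).trans (hp m)) (dist_nonneg.trans (hp m))
  have h1 := le_cappedDist (u := u) (v := v) hmem
  simp only [dist_self] at h1
  rw [min_eq_left hg, sub_zero] at h1
  by_contra! hge
  rw [min_eq_right hge] at h1
  linarith

/-- The test function is `0` on the vertices linked to `v` and `g` elsewhere: an edge across which
it jumps weighs more than `τ ≥ g`. -/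
theorem linked_of_cappedDist_lt (hw : ∀ m, 0 ≤ w m) (hg : 0 ≤ g) (hgτ : g ≤ τ)
    (h : cappedDist e w g u v < g) : Linked e w τ u v := by
  classical
  by_contra hnot
  have hmem : (fun z => if Linked e w τ z v then 0 else g) ∈ edgeLipschitz e w g := by
    refine ⟨fun m => ?_, fun z => by dsimp only; split_ifs <;> simp [hg]⟩
    by_cases hm : w m ≤ τ
    · have hl : Linked e w τ (e m).1 (e m).2 := .rel _ _ ⟨m, hm, rfl⟩
      have : Linked e w τ (e m).1 v ↔ Linked e w τ (e m).2 v :=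
        ⟨fun h => (hl.symm _ _).trans _ _ _ h, fun h => hl.trans _ _ _ h⟩
      simp only [this, sub_self, abs_zero]
      exact hw m
    · have : g ≤ w m := hgτ.trans (not_le.1 hm).le
      dsimp only
      split_ifs <;> simp [abs_of_nonneg hg, this, hw m]
  have h1 := le_cappedDist (u := u) (v := v) hmem
  simp only [if_neg hnot] at h1
  rw [if_pos (show Linked e w τ v v from .refl v)] at h1
  linarith

/-- Along linked vertices, the variation of a function is at most its total variation over the
edges. -/
theorem sub_le_sum_of_linked [Fintype ι] [DecidablePred fun m => w m ≤ τ] (f : V → ℝ)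
    (h : Linked e w τ u v) :
    f v - f u ≤ ∑ m with w m ≤ τ, |f (e m).1 - f (e m).2| := by
  -- A discrete intermediate value theorem: a value `c` missed by every edge interval would separate
  -- `u` from `v`. Lebesgue measure then turns the covering into the bound.
  have hcover : Set.Ioo (f u) (f v) ⊆
      ⋃ m ∈ (Finset.univ.filter fun m => w m ≤ τ), Set.uIcc (f (e m).1) (f (e m).2) := by
    intro c hc
    by_contra hnot
    simp only [Set.mem_iUnion, Finset.mem_filter, Finset.mem_univ, true_and, not_exists] at hnot
    have key : ∀ a b, Linked e w τ a b → (f a < c ↔ f b < c) := by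
      intro a b hab
      induction hab with
      | rel a b hr =>
        obtain ⟨m, hm, he⟩ := hr
        have := hnot m hm
        rw [he, Set.mem_uIcc] at this
        push Not at this
        constructor
        · intro h; by_contra! h'; exact absurd (this.1 h.le) (not_lt.2 h')
        · intro h; by_contra! h'; exact absurd (this.2 h.le) (not_lt.2 h')
      | refl a => rfl
      | symm a b _ ih => exact ih.symm
      | trans a b c _ _ ih1 ih2 => exact ih1.trans ih2
    have := (key u v h).1 hc.1
    exact absurd hc.2 (not_lt.2 this.le)
  have hsum : (0 : ℝ) ≤ ∑ m with w m ≤ τ, |f (e m).1 - f (e m).2| :=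
    Finset.sum_nonneg fun _ _ => abs_nonneg _
  have hvol := MeasureTheory.measure_mono (μ := MeasureTheory.volume) hcover
  rw [Real.volume_Ioo] at hvol
  have h2 := hvol.trans (MeasureTheory.measure_biUnion_finset_le _ _)
  simp only [Real.volume_interval] at h2
  rw [← ENNReal.ofReal_sum_of_nonneg (fun _ _ => abs_nonneg _),
    ENNReal.ofReal_le_ofReal_iff (Finset.sum_nonneg fun _ _ => abs_nonneg _)] at h2
  simpa only [abs_sub_comm] using h2

variable (e w g) in
theorem exists_net [Fintype V] (hg : 0 < g) :
    ∃ R : Finset V, (∀ u ∈ R, ∀ v ∈ R, u ≠ v → g ≤ cappedDist e w g u v) ∧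
      ∀ v, ∃ u ∈ R, cappedDist e w g v u < g ∨ cappedDist e w g u v < g := by
  classical
  let S : Set (Finset V) := {R | ∀ u ∈ R, ∀ v ∈ R, u ≠ v → g ≤ cappedDist e w g u v}
  obtain ⟨R, hR⟩ := (Set.toFinite S).exists_maximal ⟨∅, by simp [S]⟩
  refine ⟨R, hR.prop, fun v => ?_⟩
  by_contra! hv
  have hmem : insert v R ∈ S := by
    intro a ha b hb hab
    rcases Finset.mem_insert.1 ha with rfl | ha' <;> rcases Finset.mem_insert.1 hb with rfl | hb'
    · exact absurd rfl hab
    · exact (hv b hb').1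
    · exact (hv a ha').2
    · exact hR.prop a ha' b hb' hab
  have hvR : v ∈ R := hR.le_of_ge hmem (Finset.subset_insert _ _) (Finset.mem_insert_self _ _)
  have := (hv v hvR).1
  linarith [cappedDist_self (e := e) (w := w) (g := g) v]

variable (e w g) in
/-- A maximal set of vertices with mutual capped distances `g`. -/
noncomputable def net [Fintype V] : Finset V :=
  open Classical in if hg : 0 < g then (exists_net e w g hg).choose else ∅

theorem le_cappedDist_of_mem_net [Fintype V] (hg : 0 < g) (hu : u ∈ net e w g)
    (hv : v ∈ net e w g) (huv : u ≠ v) : g ≤ cappedDist e w g u v := by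
  rw [net, dif_pos hg] at hu hv
  exact (exists_net e w g hg).choose_spec.1 u hu v hv huv

theorem exists_mem_net_cappedDist_lt [Fintype V] (hw : ∀ m, 0 ≤ w m) (hg : 0 < g) (v : V) :
    ∃ u ∈ net e w g, cappedDist e w g v u < g := by
  obtain ⟨u, hu, h⟩ := (exists_net e w g hg).choose_spec.2 v
  refine ⟨u, by rw [net, dif_pos hg]; exact hu, ?_⟩
  rcases h with h | h
  · exact h
  · rwa [cappedDist_comm hw hg.le]

variable (e w g) in
/-- A net point at capped distance less than `g`. -/
noncomputable def netPoint [Fintype V] (v : V) : V :=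
  open Classical in if h : ∃ u ∈ net e w g, cappedDist e w g v u < g then h.choose else v

theorem netPoint_spec [Fintype V] (hw : ∀ m, 0 ≤ w m) (hg : 0 < g) (v : V) :
    netPoint e w g v ∈ net e w g ∧ cappedDist e w g v (netPoint e w g v) < g := by
  have h := exists_mem_net_cappedDist_lt (e := e) hw hg v
  rw [netPoint, dif_pos h]
  exact h.choose_spec

variable (e w g τ) in
/-- The net points that are linked to other net points. -/
noncomputable def activeNet [Fintype V] : Finset V :=
  open Classical in (net e w g).filter fun u => ∃ v ∈ net e w g, v ≠ u ∧ Linked e w τ u v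

open Classical in
-- For an active `u`, the capped distance from `u`, cut off at `g / 2`, rises by `g / 2` on the way
-- to another linked net point, so its total variation over the edges is at least that. The balls of
-- radius `g / 2` about net points are disjoint, so each end of an edge lies in at most one of them;
-- an edge is charged at most twice, each time at most `min (w m) (g / 2)`.
theorem card_activeNet_mul_le [Fintype V] [Fintype ι] (hw : ∀ m, 0 ≤ w m) (hg : 0 < g) :
    (activeNet e w g τ).card * (g / 2) ≤ ∑ m with w m ≤ τ, 2 * min (w m) (g / 2) := by
  set F : V → V → ℝ := fun u v => min (cappedDist e w g u v) (g / 2) with hF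
  have h1 : ∀ u ∈ activeNet e w g τ,
      g / 2 ≤ ∑ m with w m ≤ τ, |F u (e m).1 - F u (e m).2| := by
    intro u hu
    simp only [activeNet, Finset.mem_filter] at hu
    obtain ⟨hu, v, hv, hvu, hl⟩ := hu
    refine le_trans ?_ (sub_le_sum_of_linked (F u) hl)
    have h1 : F u v = g / 2 :=
      min_eq_right (by linarith [le_cappedDist_of_mem_net hg hu hv hvu.symm])
    have h2 : F u u ≤ 0 := (min_le_left _ _).trans (cappedDist_self u)
    linarith
  have hone : ∀ a, (∑ u ∈ activeNet e w g τ, if cappedDist e w g u a < g / 2 then (1 : ℝ) else 0)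
      ≤ 1 := by
    intro a
    rw [Finset.sum_boole]
    norm_cast
    refine Finset.card_le_one.2 fun u hu v hv => ?_
    simp only [activeNet, Finset.mem_filter] at hu hv
    by_contra huv
    have h1 := le_cappedDist_of_mem_net hg hu.1.1 hv.1.1 huv
    have h2 := cappedDist_triangle (u := u) (v := a) (x := v) (e := e) hw hg.le
    rw [cappedDist_comm (u := a) hw hg.le] at h2
    linarith [hu.2, hv.2]
  have h2 : ∀ m, ∑ u ∈ activeNet e w g τ, |F u (e m).1 - F u (e m).2|
      ≤ 2 * min (w m) (g / 2) := by
    intro m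
    have hmin : 0 ≤ min (w m) (g / 2) := le_min (hw m) (by linarith)
    have hb : ∀ u, |F u (e m).1 - F u (e m).2| ≤
        ((if cappedDist e w g u (e m).1 < g / 2 then (1 : ℝ) else 0)
          + if cappedDist e w g u (e m).2 < g / 2 then (1 : ℝ) else 0) * min (w m) (g / 2) := by
      intro u
      have hv : |F u (e m).1 - F u (e m).2| ≤ min (w m) (g / 2) := by
        refine le_min ?_ ?_
        · refine (abs_min_sub_min_le_max _ _ _ _).trans ?_
          simp only [sub_self, abs_zero]
          refine max_le ?_ (hw m)
          have h1 := cappedDist_triangle (u := u) (v := (e m).1) (x := (e m).2) (e := e) hw hg.le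
          have h2 := cappedDist_triangle (u := u) (v := (e m).2) (x := (e m).1) (e := e) hw hg.le
          have h3 := cappedDist_edge_le (e := e) (g := g) hw m
          have h4 := cappedDist_comm (u := (e m).1) (v := (e m).2) (e := e) hw hg.le
          rw [abs_le]
          constructor <;> linarith
        · have h0 : ∀ z, 0 ≤ F u z ∧ F u z ≤ g / 2 := fun z =>
            ⟨le_min (cappedDist_nonneg hw hg.le) (by linarith), min_le_right _ _⟩
          have ha := h0 (e m).1
          have hb := h0 (e m).2
          rw [abs_le]
          constructor <;> linarith
      by_cases ha : cappedDist e w g u (e m).1 < g / 2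
      · rw [if_pos ha]
        refine hv.trans ?_
        split_ifs <;> linarith
      by_cases hb : cappedDist e w g u (e m).2 < g / 2
      · rw [if_pos hb]
        refine hv.trans ?_
        split_ifs
        linarith
      · have : F u (e m).1 - F u (e m).2 = 0 := by
          simp only [hF]
          rw [min_eq_right (not_lt.1 ha), min_eq_right (not_lt.1 hb), sub_self]
        rw [this, if_neg ha, if_neg hb]
        simp
    refine (Finset.sum_le_sum fun u _ => hb u).trans ?_
    rw [← Finset.sum_mul, Finset.sum_add_distrib]
    have ha := hone (e m).1
    have hb := hone (e m).2
    nlinarith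
  calc (activeNet e w g τ).card * (g / 2) = ∑ u ∈ activeNet e w g τ, g / 2 := by simp
    _ ≤ ∑ u ∈ activeNet e w g τ, ∑ m with w m ≤ τ, |F u (e m).1 - F u (e m).2| :=
        Finset.sum_le_sum h1
    _ = ∑ m with w m ≤ τ, ∑ u ∈ activeNet e w g τ, |F u (e m).1 - F u (e m).2| :=
        Finset.sum_comm
    _ ≤ _ := Finset.sum_le_sum fun m _ => h2 m

/-- If the net point next to `u` is not active, then all vertices linked to `u` have the same net
point. -/
theorem netPoint_eq_of_not_mem_activeNet [Fintype V] (hw : ∀ m, 0 ≤ w m) (hg : 0 < g)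
    (hgτ : g ≤ τ) (h : netPoint e w g u ∉ activeNet e w g τ) (huv : Linked e w τ u v) :
    netPoint e w g v = netPoint e w g u := by
  classical
  by_contra hne
  refine h ?_
  have hu := netPoint_spec (e := e) hw hg u
  have hv := netPoint_spec (e := e) hw hg v
  simp only [activeNet, Finset.mem_filter]
  refine ⟨hu.1, _, hv.1, hne, ?_⟩
  exact ((linked_of_cappedDist_lt hw hg.le hgτ hu.2).symm _ _).trans _ _ _
    (huv.trans _ _ _ (linked_of_cappedDist_lt hw hg.le hgτ hv.2))

end CappedDist

/-! ### Active net points over all levels -/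

/-- An edge counts only from the first level `l₀` with `w ≤ 2 * B ^ (l₀ + 1)` on. The first two
levels contribute at most `2` each, and level `l₀ + 2 + j` at most `8 / B ^ j`; all this is
dominated by the geometric series `32 / 2 ^ m`. -/
theorem sum_range_level_le {B w : ℝ} (hB : 2 ≤ B) (L : ℕ) :
    (∑ l ∈ Finset.range L, if w ≤ 2 * B ^ (l + 1) then min (4 * w * B / B ^ l) 2 else 0) ≤ 64 := by
  have hB0 : 0 < B := by linarith
  obtain ⟨l₁, hl₁⟩ : ∃ l, w ≤ 2 * B ^ (l + 1) := by
    obtain ⟨l, hl⟩ := pow_unbounded_of_one_lt w (by linarith : (1 : ℝ) < B)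
    refine ⟨l, ?_⟩
    have : B ^ l ≤ B ^ (l + 1) := pow_le_pow_right₀ (by linarith) (by omega)
    have : 0 < B ^ (l + 1) := by positivity
    linarith
  classical
  have hex : ∃ l, w ≤ 2 * B ^ (l + 1) := ⟨l₁, hl₁⟩
  set l₀ := Nat.find hex with hl₀
  have h0 : w ≤ 2 * B ^ (l₀ + 1) := Nat.find_spec hex
  have hterm : ∀ l, (if w ≤ 2 * B ^ (l + 1) then min (4 * w * B / B ^ l) 2 else 0)
      ≤ if l₀ ≤ l then 32 * (1 / 2 : ℝ) ^ (l - l₀) else 0 := by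
    intro l
    by_cases hl : l₀ ≤ l
    · rw [if_pos hl]
      obtain ⟨m, rfl⟩ := Nat.exists_eq_add_of_le hl
      rw [Nat.add_sub_cancel_left]
      have hpos : (0 : ℝ) < 32 * (1 / 2) ^ m := by positivity
      split_ifs
      · rcases Nat.lt_or_ge m 2 with hm | hm
        · refine (min_le_right _ _).trans ?_
          interval_cases m <;> norm_num
        · refine (min_le_left _ _).trans ?_
          obtain ⟨j, rfl⟩ := Nat.exists_eq_add_of_le hm
          have h1 : 4 * w * B / B ^ (l₀ + (2 + j)) ≤ 8 / B ^ j := by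
            rw [div_le_div_iff₀ (by positivity) (by positivity)]
            have h3 : 4 * B * B ^ j * w ≤ 4 * B * B ^ j * (2 * B ^ (l₀ + 1)) := by gcongr
            calc 4 * w * B * B ^ j = 4 * B * B ^ j * w := by ring
              _ ≤ 4 * B * B ^ j * (2 * B ^ (l₀ + 1)) := h3
              _ = 8 * B ^ (l₀ + (2 + j)) := by ring
          refine h1.trans ?_
          have h2 : (8 : ℝ) / B ^ j ≤ 8 / 2 ^ j := by gcongr
          refine h2.trans (le_of_eq ?_)
          rw [pow_add, one_div_pow, one_div_pow]
          ring
      · exact hpos.le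
    · rw [if_neg hl, if_neg]
      exact Nat.find_min hex (not_le.1 hl)
  refine (Finset.sum_le_sum fun l _ => hterm l).trans ?_
  rw [← Finset.sum_filter]
  have hle : ∑ l ∈ (Finset.range L).filter (fun l => l₀ ≤ l), 32 * (1 / 2 : ℝ) ^ (l - l₀)
      ≤ ∑ m ∈ Finset.range L, 32 * (1 / 2 : ℝ) ^ m := by
    rw [← Finset.sum_image (g := fun l => l - l₀) (f := fun m => 32 * (1 / 2 : ℝ) ^ m)]
    · refine Finset.sum_le_sum_of_subset_of_nonneg ?_ fun _ _ _ => by positivity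
      intro m hm
      simp only [Finset.mem_image, Finset.mem_filter, Finset.mem_range] at hm ⊢
      omega
    · intro a ha b hb hab
      simp only [Finset.coe_filter, Set.mem_ofPred_eq] at ha hb
      simp only at hab
      omega
  refine hle.trans ?_
  rw [← Finset.mul_sum]
  have := (summable_geometric_two).sum_le_tsum (Finset.range L) (fun _ _ => by positivity)
  rw [tsum_geometric_two] at this
  linarith

/-- Over all levels `l`, with resolution `B ^ l / B` and threshold `2 * B ^ (l + 1)`, the number of
active net points is linear in the number of edges. -/
theorem sum_card_activeNet_le {V ι : Type*} [Fintype V] [Fintype ι] (e : ι → V × V) {w : ι → ℝ}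
    (hw : ∀ m, 0 ≤ w m) {B : ℝ} (hB : 2 ≤ B) (L : ℕ) :
    ∑ l ∈ Finset.range L, (activeNet e w (B ^ l / B) (2 * B ^ (l + 1))).card
      ≤ 64 * Fintype.card ι := by
  classical
  have hB0 : 0 < B := by linarith
  have h : ∀ l, ((activeNet e w (B ^ l / B) (2 * B ^ (l + 1))).card : ℝ)
      ≤ ∑ m, if w m ≤ 2 * B ^ (l + 1) then min (4 * w m * B / B ^ l) 2 else 0 := by
    intro l
    have hg : 0 < B ^ l / B := by positivity
    have h1 := card_activeNet_mul_le (e := e) (τ := 2 * B ^ (l + 1)) hw hg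
    have h2 : ∀ m, 2 * min (w m) (B ^ l / B / 2) = min (4 * w m * B / B ^ l) 2 * (B ^ l / B / 2) := by
      intro m
      rw [mul_min_of_nonneg _ _ (by norm_num : (0:ℝ) ≤ 2), min_mul_of_nonneg _ _ (by positivity)]
      congr 1
      field_simp
      norm_num
      ring
    simp only [h2] at h1
    rw [← Finset.sum_mul] at h1
    rw [← Finset.sum_filter]
    exact le_of_mul_le_mul_right h1 (by positivity)
  have : (∑ l ∈ Finset.range L, ((activeNet e w (B ^ l / B) (2 * B ^ (l + 1))).card : ℝ))
      ≤ 64 * Fintype.card ι := by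
    refine (Finset.sum_le_sum fun l _ => h l).trans ?_
    rw [Finset.sum_comm]
    refine (Finset.sum_le_sum fun m _ => sum_range_level_le hB L).trans ?_
    simp [mul_comm]
  exact_mod_cast this

/-! ### Distances in the grid -/

section Grid

variable {d Φ : ℕ}

/-- A grid point as a vector. -/
noncomputable def gridVec (x : GridPoint d Φ) : EuclideanSpace ℝ (Fin d) :=
  WithLp.toLp 2 fun k => ((x k : ℤ) : ℝ)

theorem gridDist_eq_norm (x y : GridPoint d Φ) : gridDist x y = ‖gridVec x - gridVec y‖ :=
  dist_eq_norm _ _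

theorem gridDist_comm (x y : GridPoint d Φ) : gridDist x y = gridDist y x := dist_comm _ _

theorem gridDist_nonneg (x y : GridPoint d Φ) : 0 ≤ gridDist x y := dist_nonneg

theorem gridDist_triangle (x y z : GridPoint d Φ) : gridDist x z ≤ gridDist x y + gridDist y z :=
  dist_triangle (gridVec x) (gridVec y) (gridVec z)

theorem abs_gridDist_sub_le (x x' y : GridPoint d Φ) :
    |gridDist x y - gridDist x' y| ≤ gridDist x x' :=
  abs_dist_sub_le (gridVec x) (gridVec x') (gridVec y)

/-- The squared distance of two grid points. -/
def sqDist (x y : GridPoint d Φ) : ℕ := (∑ k, ((x k : ℤ) - y k) ^ 2).toNat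

theorem coe_sqDist (x y : GridPoint d Φ) : (sqDist x y : ℤ) = ∑ k, ((x k : ℤ) - y k) ^ 2 :=
  Int.toNat_of_nonneg (Finset.sum_nonneg fun _ _ => sq_nonneg _)

theorem sqrt_sqDist (x y : GridPoint d Φ) : √(sqDist x y : ℝ) = gridDist x y := by
  have h : ((sqDist x y : ℤ) : ℝ) = ∑ k, (((x k : ℤ) : ℝ) - (y k : ℤ)) ^ 2 := by
    rw [coe_sqDist]; push_cast; rfl
  rw [gridDist, EuclideanSpace.dist_eq]
  congr 1
  rw [Int.cast_natCast] at h
  rw [h]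
  exact Finset.sum_congr rfl fun k _ => by simp [Real.dist_eq, sq_abs]

theorem sqDist_le (x y : GridPoint d Φ) : sqDist x y ≤ 4 * d * Φ ^ 2 := by
  have h : (sqDist x y : ℤ) ≤ ∑ _k : Fin d, 4 * (Φ : ℤ) ^ 2 := by
    rw [coe_sqDist]
    refine Finset.sum_le_sum fun k _ => ?_
    have hx := (x k).2
    have hy := (y k).2
    rw [Set.mem_Icc] at hx hy
    nlinarith
  simp only [Finset.sum_const, Finset.card_univ, Fintype.card_fin, nsmul_eq_mul] at h
  have : (sqDist x y : ℤ) ≤ (4 * d * Φ ^ 2 : ℕ) := by push_cast; linarith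
  exact_mod_cast this

theorem gridDist_lt_two_pow (x y : GridPoint d Φ) :
    gridDist x y < 2 ^ (Nat.log 2 (2 * d * Φ) + 1) := by
  have h1 : gridDist x y ≤ (2 * d * Φ : ℕ) := by
    rw [← sqrt_sqDist, Real.sqrt_le_left (by positivity)]
    have h2 : sqDist x y ≤ (2 * d * Φ) ^ 2 := by
      refine (sqDist_le x y).trans ?_
      have : d ≤ d ^ 2 := Nat.le_self_pow (by norm_num) d
      calc 4 * d * Φ ^ 2 ≤ 4 * d ^ 2 * Φ ^ 2 := by gcongr
        _ = (2 * d * Φ) ^ 2 := by ring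
    exact_mod_cast h2
  refine h1.trans_lt ?_
  exact_mod_cast Nat.lt_pow_succ_log_self (by norm_num) _

theorem one_le_gridDist {x y : GridPoint d Φ} (h : gridDist x y ≠ 0) : 1 ≤ gridDist x y := by
  rw [← sqrt_sqDist] at h ⊢
  have : sqDist x y ≠ 0 := by
    rintro h0
    simp [h0] at h
  rw [Real.one_le_sqrt]
  exact_mod_cast Nat.one_le_iff_ne_zero.2 this

end Grid

/-! ### Samples that are accurate for a given vector -/

/-- The binary logarithm of a distance, rounded down. -/
noncomputable def nearScale (D : ℝ) : ℕ := Nat.log 2 ⌊D⌋₊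

theorem lt_two_pow_nearScale (D : ℝ) : D < 2 ^ (nearScale D + 1) := by
  refine (Nat.lt_floor_add_one D).trans_le ?_
  exact_mod_cast Nat.lt_pow_succ_log_self (by norm_num : 1 < 2) ⌊D⌋₊

theorem two_pow_nearScale_le {D : ℝ} (h : 1 ≤ D) : 2 ^ nearScale D ≤ D := by
  refine le_trans ?_ (Nat.floor_le (by linarith : 0 ≤ D))
  exact_mod_cast Nat.pow_log_le_self 2 (Nat.floor_pos.2 h).ne'

section Accuracy

variable {E : Type*} [NormedAddCommGroup E] [InnerProductSpace ℝ E] {k : ℕ}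

/-- The empirical characteristic function of the samples `G` in direction `z`, at scale `σ`. -/
noncomputable def meanCos (G : Fin k → E) (z : E) (σ : ℝ) : ℝ :=
  (∑ j, Real.cos (inner ℝ (G j) z / σ)) / k

/-- The samples estimate the Gaussian characteristic function up to `κ` at the scales `2 ^ i`,
`i < J`. -/
def AccurateAll (κ : ℝ) (J : ℕ) (G : Fin k → E) (z : E) : Prop :=
  ∀ i < J, |meanCos G z (2 ^ i) - Real.exp (-(‖z‖ / 2 ^ i) ^ 2 / 2)| ≤ κ

/-- The samples estimate the Gaussian characteristic function up to `κ` at the scales next to `‖z‖`,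
and their empirical characteristic function is close to one at coarser scales. -/
def AccurateNear (κ : ℝ) (G : Fin k → E) (z : E) : Prop :=
  (∀ i, nearScale ‖z‖ ≤ i → i < nearScale ‖z‖ + 3 →
    |meanCos G z (2 ^ i) - Real.exp (-(‖z‖ / 2 ^ i) ^ 2 / 2)| ≤ κ) ∧
  ∀ i, nearScale ‖z‖ + 3 ≤ i → 19 / 20 + κ ≤ meanCos G z (2 ^ i)

variable [FiniteDimensional ℝ E] [MeasurableSpace E] [BorelSpace E]

theorem integral_cos_inner_div_stdGaussian (z : E) {σ : ℝ} (hσ : 0 < σ) :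
    ∫ x, Real.cos (inner ℝ x z / σ) ∂(stdGaussian E) = Real.exp (-(‖z‖ / σ) ^ 2 / 2) := by
  have := integral_cos_inner_stdGaussian (σ⁻¹ • z)
  rw [norm_smul, norm_inv, Real.norm_of_nonneg hσ.le] at this
  simp only [inner_smul_right] at this
  convert this using 3 <;> ring_nf

theorem exists_seeds_accurateAll {Z : Type*} [Fintype Z] (p : Z → E) {J k t : ℕ} (hk : 0 < k)
    (ht : 0 < t) {κ η : ℝ} (hκ : 0 ≤ κ) (hη : 0 < η)
    (hkη : 2 * (J : ℝ) * Real.exp (-(k * κ ^ 2 / 2)) ≤ η / 2)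
    (htη : 2 * (Fintype.card Z : ℝ) * Real.exp (-(t * (η / 2) ^ 2 / 2)) < 1) :
    ∃ G : Fin t → Fin k → E, ∀ z,
      (Nat.card {a : Fin t // ¬ AccurateAll κ J (G a) (p z)} : ℝ) ≤ η * t := by
  obtain ⟨G, hG⟩ := exists_seeds (stdGaussian E)
    (fun (z : Z) (i : Fin J) x => Real.cos (inner ℝ x (p z) / 2 ^ (i : ℕ)))
    (fun z i => by fun_prop) (fun z i ω => ⟨Real.neg_one_le_cos _, Real.cos_le_one _⟩)
    hk ht hκ hη (by simpa using hkη) htη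
  refine ⟨G, fun z => le_trans ?_ (hG z)⟩
  refine Nat.cast_le.2 (Nat.card_le_card_of_injective (fun a => ⟨a.1, ?_⟩) fun a b h => by
    simpa [Subtype.ext_iff] using h)
  by_contra! hcon
  refine a.2 fun i hi => ?_
  have := hcon ⟨i, hi⟩
  rw [integral_cos_inner_div_stdGaussian _ (by positivity)] at this
  exact this.le

theorem one_sub_cos_le_two_mul_min (θ α : ℝ) (h : θ ^ 2 ≤ 4 * α ^ 2) :
    1 - Real.cos θ ≤ 2 * min 1 (α ^ 2) := by
  rw [mul_min_of_nonneg _ _ (by norm_num)]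
  refine le_min ?_ ?_
  · linarith [Real.neg_one_le_cos θ]
  · linarith [Real.one_sub_sq_div_two_le_cos (x := θ)]

/-- Four bounded statistics suffice, however many scales there are: the cosines at the three scales
next to `‖p z‖`, and a truncated square that bounds `1 - cos` at all coarser scales at once. -/
theorem exists_seeds_accurateNear {Z : Type*} [Fintype Z] (p : Z → E) {k t : ℕ} (hk : 0 < k)
    (ht : 0 < t) {κ η : ℝ} (hκ : 0 ≤ κ) (hκ' : κ ≤ 1 / 4000) (hη : 0 < η)
    (hkη : 8 * Real.exp (-(k * κ ^ 2 / 2)) ≤ η / 2)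
    (htη : 2 * (Fintype.card Z : ℝ) * Real.exp (-(t * (η / 2) ^ 2 / 2)) < 1) :
    ∃ G : Fin t → Fin k → E, ∀ z,
      (Nat.card {a : Fin t // ¬ AccurateNear κ (G a) (p z)} : ℝ) ≤ η * t := by
  have hmin : ∀ x : ℝ, 0 ≤ min 1 (x ^ 2) := fun x => le_min zero_le_one (sq_nonneg _)
  obtain ⟨G, hG⟩ := exists_seeds (stdGaussian E)
    (fun (z : Z) (i : Option (Fin 3)) x => i.elim
      (min 1 ((inner ℝ x ((2 ^ (nearScale ‖p z‖ + 4) : ℝ)⁻¹ • p z)) ^ 2))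
      fun i => Real.cos (inner ℝ x (p z) / 2 ^ (nearScale ‖p z‖ + i : ℕ)))
    (fun z i => by cases i <;> dsimp only [Option.elim] <;> fun_prop)
    (fun z i ω => by
      cases i
      · exact ⟨le_trans (by norm_num)
          (hmin (inner ℝ ω ((2 ^ (nearScale ‖p z‖ + 4) : ℝ)⁻¹ • p z))), min_le_left _ _⟩
      · exact ⟨Real.neg_one_le_cos _, Real.cos_le_one _⟩)
    hk ht hκ hη (by norm_num [Fintype.card_option]; exact hkη) htη
  refine ⟨G, fun z => le_trans ?_ (hG z)⟩
  refine Nat.cast_le.2 (Nat.card_le_card_of_injective (fun a => ⟨a.1, ?_⟩) fun a b h => by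
    simpa [Subtype.ext_iff] using h)
  by_contra! hcon
  refine a.2 ⟨fun i hi hi3 => ?_, fun i hi => ?_⟩
  · obtain ⟨c, rfl⟩ := Nat.exists_eq_add_of_le hi
    have := hcon (some ⟨c, by omega⟩)
    dsimp only [Option.elim] at this
    rw [integral_cos_inner_div_stdGaussian _ (by positivity)] at this
    exact this.le
  · have h0 := hcon none
    dsimp only [Option.elim] at h0
    set i₀ := nearScale ‖p z‖
    have hI := integral_min_one_sq_inner_stdGaussian_le ((2 ^ (i₀ + 4) : ℝ)⁻¹ • p z)
    -- The truncated square has mean at most `1 / 64`, hence empirical mean at most `1 / 64 + κ`.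
    -- Doubled, this stays below `1 / 20 - κ`.
    have hn : ‖(2 ^ (i₀ + 4) : ℝ)⁻¹ • p z‖ ≤ 1 / 8 := by
      rw [norm_smul, norm_inv, Real.norm_of_nonneg (by positivity), inv_mul_le_iff₀ (by positivity)]
      have := (lt_two_pow_nearScale ‖p z‖).le
      calc ‖p z‖ ≤ 2 ^ (i₀ + 1) := this
        _ = 2 ^ (i₀ + 4) * (1 / 8) := by ring
    have hn2 : ‖(2 ^ (i₀ + 4) : ℝ)⁻¹ • p z‖ ^ 2 ≤ 1 / 64 := by
      calc _ ≤ (1 / 8 : ℝ) ^ 2 := by gcongr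
        _ = 1 / 64 := by norm_num
    have h1 := (abs_lt.1 h0).2
    have hk' : (0 : ℝ) < k := by exact_mod_cast hk
    have hterm : ∀ j, 1 - Real.cos (inner ℝ (G a j) (p z) / 2 ^ i)
        ≤ 2 * min 1 ((inner ℝ (G a j) ((2 ^ (i₀ + 4) : ℝ)⁻¹ • p z)) ^ 2) := by
      intro j
      refine one_sub_cos_le_two_mul_min _ _ ?_
      rw [inner_smul_right]
      obtain ⟨c, rfl⟩ := Nat.exists_eq_add_of_le hi
      have h2c : (1 : ℝ) ≤ 2 ^ c := one_le_pow₀ (by norm_num)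
      have : inner ℝ (G a j) (p z) / 2 ^ (i₀ + 3 + c)
          = 2 * ((2 ^ (i₀ + 4) : ℝ)⁻¹ * inner ℝ (G a j) (p z)) / 2 ^ c := by
        field_simp
        ring
      rw [this, div_pow, div_le_iff₀ (by positivity)]
      have h2c' : (1 : ℝ) ≤ (2 ^ c) ^ 2 := one_le_pow₀ h2c
      nlinarith [sq_nonneg ((2 ^ (i₀ + 4) : ℝ)⁻¹ * inner ℝ (G a j) (p z))]
    have hsum := Finset.sum_le_sum fun j (_ : j ∈ (Finset.univ : Finset (Fin k))) => hterm j
    rw [Finset.sum_sub_distrib, ← Finset.mul_sum] at hsum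
    simp only [Finset.sum_const, Finset.card_univ, Fintype.card_fin, nsmul_eq_mul, mul_one] at hsum
    unfold meanCos
    rw [le_div_iff₀ hk']
    have h3 : (∑ j, min 1 ((inner ℝ (G a j) ((2 ^ (i₀ + 4) : ℝ)⁻¹ • p z)) ^ 2))
        ≤ (1 / 64 + κ) * k := by
      rw [← div_le_iff₀ hk']
      linarith
    nlinarith

end Accuracy

/-! ### Angle codes and their read-off -/

section Codes

variable {d Φ k : ℕ}

/-- The modular code of the angles of `x` relative to the samples `G`. -/
noncomputable def angleCode (s : ℝ) (W V : ℕ) (G : Fin k → EuclideanSpace ℝ (Fin d))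
    (x : GridPoint d Φ) : Fin k → Fin (2 ^ (W + V)) :=
  fun t => encodeAngle s W V (inner ℝ (G t) (gridVec x))

/-- The distance between `y` and the point with the angle code `c`. -/
noncomputable def readOff (κ s : ℝ) (W V : ℕ) (G : Fin k → EuclideanSpace ℝ (Fin d))
    (c : Fin k → Fin (2 ^ (W + V))) (y : GridPoint d Φ) : Option ℝ :=
  estimate κ s V (observed s W V c fun t => inner ℝ (G t) (gridVec y))

theorem abs_observed_angleCode_sub_le (j W V : ℕ) (hk : 0 < k)
    (G : Fin k → EuclideanSpace ℝ (Fin d)) (x y : GridPoint d Φ) {i : ℕ} (hi : i < V) :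
    |observed (2 ^ j) W V (angleCode (2 ^ j) W V G x) (fun t => inner ℝ (G t) (gridVec y)) i
      - meanCos G (gridVec x - gridVec y) (2 ^ (j + i))| ≤ 2 * Real.pi / 2 ^ W := by
  have h := abs_observed_sub_le (s := 2 ^ j) (by positivity) W V hk
    (fun t => inner ℝ (G t) (gridVec x)) (fun t => inner ℝ (G t) (gridVec y)) hi.le
  unfold angleCode
  simpa only [meanCos, inner_sub_right, pow_add] using h

theorem abs_observed_angleCode_sub_exp_le {κ : ℝ} {j W V J : ℕ} (hk : 0 < k)
    (hW : 2 * Real.pi / 2 ^ W ≤ κ) (hJ : j + V ≤ J) {G : Fin k → EuclideanSpace ℝ (Fin d)}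
    {x y : GridPoint d Φ} (hG : AccurateAll κ J G (gridVec x - gridVec y)) :
    ∀ i < V, |observed (2 ^ j) W V (angleCode (2 ^ j) W V G x)
      (fun t => inner ℝ (G t) (gridVec y)) i
        - Real.exp (-(gridDist x y / (2 ^ j * 2 ^ i)) ^ 2 / 2)| ≤ 2 * κ := by
  intro i hi
  have h1 := abs_observed_angleCode_sub_le j W V hk G x y hi
  have h2 := hG (j + i) (by omega)
  rw [← gridDist_eq_norm] at h2
  rw [← pow_add]
  calc _ ≤ _ := abs_sub_le _ _ _
    _ ≤ 2 * Real.pi / 2 ^ W + κ := add_le_add h1 h2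
    _ ≤ 2 * κ := by linarith

theorem abs_sub_gridDist_le_of_readOff {κ e : ℝ} {j W V J : ℕ} (hk : 0 < k)
    (hκ : κ ≤ 1 / 4000) (hW : 2 * Real.pi / 2 ^ W ≤ κ) (hJ : j + V ≤ J)
    {G : Fin k → EuclideanSpace ℝ (Fin d)} {x y : GridPoint d Φ}
    (hG : AccurateAll κ J G (gridVec x - gridVec y))
    (h : readOff κ (2 ^ j) W V G (angleCode (2 ^ j) W V G x) y = some e) :
    |e - gridDist x y| ≤ 6400 * κ * e ∧ 2 ^ j / 2 ≤ e :=
  abs_sub_le_of_estimate (by positivity) hκ (gridDist_nonneg x y)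
    (abs_observed_angleCode_sub_exp_le hk hW hJ hG) h

theorem exists_readOff_eq_some {κ : ℝ} {j W V J i : ℕ} (hk : 0 < k)
    (hW : 2 * Real.pi / 2 ^ W ≤ κ) (hJ : j + V ≤ J)
    {G : Fin k → EuclideanSpace ℝ (Fin d)} {x y : GridPoint d Φ}
    (hG : AccurateAll κ J G (gridVec x - gridVec y)) (hi : i < V)
    (h1 : 1 / 2 ≤ gridDist x y / (2 ^ j * 2 ^ i)) (h2 : gridDist x y / (2 ^ j * 2 ^ i) ≤ 3) :
    ∃ e, readOff κ (2 ^ j) W V G (angleCode (2 ^ j) W V G x) y = some e :=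
  exists_estimate_eq_some hi (e := gridDist x y)
    ⟨h1, h2, by rw [abs_sub_comm]; exact abs_observed_angleCode_sub_exp_le hk hW hJ hG i hi⟩

/-- Distinct grid points have distance at least `1`, so the finest scale `2 ^ 0` suffices. At
distance zero all observed values are close to one, nothing is admissible, and the default `0` is
the exact answer. -/
theorem abs_getD_readOff_sub_le {κ : ℝ} {W V : ℕ} (hk : 0 < k)
    (hκ : κ ≤ 1 / 4000) (hW : 2 * Real.pi / 2 ^ W ≤ κ)
    {G : Fin k → EuclideanSpace ℝ (Fin d)} {x y : GridPoint d Φ} (hV : gridDist x y < 2 ^ V)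
    (hG : AccurateNear κ G (gridVec x - gridVec y)) :
    |(readOff κ (2 ^ 0) W V G (angleCode (2 ^ 0) W V G x) y).getD 0 - gridDist x y|
      ≤ 6400 * κ * (readOff κ (2 ^ 0) W V G (angleCode (2 ^ 0) W V G x) y).getD 0 := by
  obtain ⟨hG1, hG2⟩ := hG
  rw [← gridDist_eq_norm] at hG1 hG2
  by_cases h0 : gridDist x y = 0
  · have hv : ∀ i < V, 19 / 20 ≤ observed (2 ^ 0) W V (angleCode (2 ^ 0) W V G x)
        (fun t => inner ℝ (G t) (gridVec y)) i := by
      intro i hi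
      have h1 := (abs_le.1 (abs_observed_angleCode_sub_le 0 W V hk G x y hi)).1
      have hz : gridVec x - gridVec y = 0 := by rwa [gridDist_eq_norm, norm_eq_zero] at h0
      have hm : meanCos G (gridVec x - gridVec y) (2 ^ (0 + i)) = 1 := by
        have hk' : (k : ℝ) ≠ 0 := by exact_mod_cast hk.ne'
        simp [meanCos, hz, hk']
      rw [hm] at h1
      linarith
    rw [readOff, estimate_eq_none_of_le hκ hv, h0]
    simp
  · have h1 := one_le_gridDist h0
    have hlow := two_pow_nearScale_le h1
    have hup := lt_two_pow_nearScale (gridDist x y)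
    have hi₀ : nearScale (gridDist x y) < V := by
      have : (2 : ℝ) ^ nearScale (gridDist x y) < 2 ^ V := hlow.trans_lt hV
      exact (pow_lt_pow_iff_right₀ (by norm_num : (1 : ℝ) < 2)).1 this
    obtain ⟨e, he, he'⟩ := exists_estimate_of_accurate_near (κ := κ) (s := 2 ^ 0)
      (D := gridDist x y) (V := V) (i₀ := nearScale (gridDist x y))
      (v := observed (2 ^ 0) W V (angleCode (2 ^ 0) W V G x)
        (fun t => inner ℝ (G t) (gridVec y))) (by norm_num) hκ hi₀
      (by simpa using hlow) (by simpa using hup)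
      (fun i hi hi1 hi2 => by
        have h1 := abs_observed_angleCode_sub_le 0 W V hk G x y hi
        have h2 := hG1 i hi1 hi2
        rw [zero_add] at h1
        rw [← pow_add, zero_add]
        calc _ ≤ _ := abs_sub_le _ _ _
          _ ≤ 2 * Real.pi / 2 ^ W + κ := add_le_add h1 h2
          _ ≤ 2 * κ := by linarith)
      (fun i hi hi1 => by
        have h1 := (abs_le.1 (abs_observed_angleCode_sub_le 0 W V hk G x y hi)).1
        have h2 := hG2 i hi1
        rw [zero_add] at h1
        linarith)
    rw [readOff, he]
    exact he'

end Codes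

/-! ### The spanning tree and the storage of active codes -/

/-- The edges of a graph on `Fin n` with their squared weights. -/
abbrev WeightedEdges (n N : ℕ) : Type := Fin n → (Fin n × Fin n) × Fin (N + 1)

namespace WeightedEdges

variable {n N : ℕ} (T : WeightedEdges n N)

/-- The end points of the edges. -/
def ends (m : Fin n) : Fin n × Fin n := (T m).1

/-- The weights of the edges. -/
noncomputable def weight (m : Fin n) : ℝ := √((T m).2 : ℕ)

theorem weight_nonneg (m : Fin n) : 0 ≤ T.weight m := Real.sqrt_nonneg _

/-- The resolution of level `l`. -/
noncomputable def resolution (W l : ℕ) : ℝ := (2 ^ W) ^ l / 2 ^ W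

theorem resolution_pos (W l : ℕ) : 0 < resolution W l := by unfold resolution; positivity

/-- The active net points of level `l`. -/
noncomputable def active (W l : ℕ) : Finset (Fin n) :=
  activeNet T.ends T.weight (resolution W l) (2 * (2 ^ W) ^ (l + 1))

/-- The net point of level `l` that represents `i`. -/
noncomputable def rep (W l : ℕ) (i : Fin n) : Fin n :=
  netPoint T.ends T.weight (resolution W l) i

/-- The active net points of all levels below `L`. -/
noncomputable def activePairs (W L : ℕ) : Finset (Fin L × Fin n) :=
  Finset.univ.filter fun p => p.2 ∈ T.active W p.1

theorem card_activePairs_le {W : ℕ} (hW : 0 < W) (L : ℕ) :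
    (T.activePairs W L).card ≤ 64 * n := by
  classical
  have hB : (2 : ℝ) ≤ 2 ^ W := by
    calc (2 : ℝ) = 2 ^ 1 := by norm_num
      _ ≤ 2 ^ W := pow_le_pow_right₀ (by norm_num) hW
  have h := sum_card_activeNet_le T.ends T.weight_nonneg hB L
  rw [Fintype.card_fin] at h
  refine le_trans (le_of_eq ?_) h
  rw [← Fin.sum_univ_eq_sum_range fun l => (activeNet T.ends T.weight ((2 ^ W) ^ l / 2 ^ W)
    (2 * (2 ^ W) ^ (l + 1))).card, activePairs, Finset.card_filter, Fintype.sum_prod_type]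
  refine Finset.sum_congr rfl fun l _ => ?_
  rw [← Finset.card_filter]
  congr 1
  ext i
  rw [Finset.mem_filter]
  exact ⟨And.right, fun h => ⟨Finset.mem_univ _, h⟩⟩

theorem exists_slot {W : ℕ} (hW : 0 < W) (L : ℕ) [NeZero n] :
    ∃ f : Fin L × Fin n → Fin (64 * n), Set.InjOn f (T.activePairs W L) := by
  classical
  have hn : 0 < 64 * n := by have := NeZero.pos n; omega
  have hcard := T.card_activePairs_le hW L
  refine ⟨fun p => if h : p ∈ T.activePairs W L then
    ⟨(T.activePairs W L).equivFin ⟨p, h⟩, ((T.activePairs W L).equivFin ⟨p, h⟩).2.trans_le hcard⟩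
    else ⟨0, hn⟩, fun p hp p' hp' hpp => ?_⟩
  rw [Finset.mem_coe] at hp hp'
  simp only [dif_pos hp, dif_pos hp', Fin.mk.injEq] at hpp
  have := (T.activePairs W L).equivFin.injective (Fin.ext hpp)
  simpa using this

/-- The position in the message of the code of an active net point. -/
noncomputable def slot (W L : ℕ) [NeZero n] : Fin L × Fin n → Fin (64 * n) :=
  open Classical in if hW : 0 < W then (T.exists_slot hW L).choose
    else fun _ => ⟨0, by have := NeZero.pos n; omega⟩

theorem injOn_slot {W : ℕ} (hW : 0 < W) (L : ℕ) [NeZero n] :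
    Set.InjOn (T.slot W L) (T.activePairs W L) := by
  rw [slot, dif_pos hW]
  exact (T.exists_slot hW L).choose_spec

open Classical in
/-- The message that holds the values of `code` at the active net points. -/
noncomputable def store {M : Type*} [Inhabited M] (W L : ℕ) [NeZero n]
    (code : Fin L × Fin n → M) (m : Fin (64 * n)) : M :=
  if h : ∃ p ∈ T.activePairs W L, T.slot W L p = m then code h.choose else default

theorem store_slot {M : Type*} [Inhabited M] {W L : ℕ} [NeZero n] (hW : 0 < W)
    (code : Fin L × Fin n → M) {p : Fin L × Fin n} (hp : p ∈ T.activePairs W L) :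
    T.store W L code (T.slot W L p) = code p := by
  have h : ∃ p' ∈ T.activePairs W L, T.slot W L p' = T.slot W L p := ⟨p, hp, rfl⟩
  rw [store, dif_pos h]
  exact congrArg code (T.injOn_slot hW L h.choose_spec.1 hp h.choose_spec.2)

/-- `T` is a minimum spanning tree of the points `x`. -/
structure IsSpanning {d Φ : ℕ} (x : Fin n → GridPoint d Φ) : Prop where
  weight_eq : ∀ m, T.weight m = gridDist (x (T.ends m).1) (x (T.ends m).2)
  linked : ∀ u v s, gridDist (x u) (x v) ≤ s → Linked T.ends T.weight s u v

/-- Below the cap, the path metric of the tree dominates the Euclidean metric, so a net computed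
from the tree alone, without the points, still approximates the points. -/
theorem IsSpanning.dist_rep_lt {T : WeightedEdges n N} {d Φ : ℕ} {x : Fin n → GridPoint d Φ} (hT : T.IsSpanning x) (W l : ℕ)
    (i : Fin n) : gridDist (x i) (x (T.rep W l i)) < resolution W l :=
  dist_lt_of_cappedDist_lt (fun i => gridVec (x i)) (fun m => (hT.weight_eq m).ge)
    (resolution_pos W l).le (netPoint_spec T.weight_nonneg (resolution_pos W l) i).2

end WeightedEdges

/-- Squared grid distances are bounded integers, so the edge lengths can be transmitted exactly. -/
theorem exists_isSpanning {n d Φ : ℕ} (x : Fin n → GridPoint d Φ) :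
    ∃ T : WeightedEdges n (4 * d * Φ ^ 2), T.IsSpanning x := by
  obtain ⟨e, he⟩ := exists_bottleneck_edges (fun u v => gridDist (x u) (x v))
    fun u v => gridDist_comm _ _
  let T : WeightedEdges n (4 * d * Φ ^ 2) := fun m =>
    (e m, ⟨sqDist (x (e m).1) (x (e m).2), Nat.lt_succ_of_le (sqDist_le _ _)⟩)
  have hw : ∀ m, T.weight m = gridDist (x (T.ends m).1) (x (T.ends m).2) := fun m =>
    sqrt_sqDist _ _
  refine ⟨T, hw, fun u v s huv => ?_⟩
  refine (he u v s huv).mono fun a b hab => ?_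
  obtain ⟨m, hm, hme⟩ := hab
  exact ⟨m, (hw m).trans_le hm, hme⟩

/-! ### Bob's estimates and their accuracy -/

section Decoding

variable {n d Φ N k₁ k₂ : ℕ} [NeZero n]

namespace WeightedEdges

variable (T : WeightedEdges n N) (κ : ℝ) (W L V : ℕ)

open Classical in
/-- The distance between `y` and data point `i` at level `l`, if it is of the order of that level and
the net point that represents `i` is active. -/
noncomputable def levelEstimate (h : Fin (64 * n) → Fin k₁ → Fin (2 ^ (W + W)))
    (G : Fin k₁ → EuclideanSpace ℝ (Fin d)) (y : GridPoint d Φ) (i : Fin n) (l : Fin L) :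
    Option ℝ :=
  if (l, T.rep W l i) ∈ T.activePairs W L then
    readOff κ (2 ^ (W * l)) W W G (h (T.slot W L (l, T.rep W l i))) y else none

/-- No level yields an estimate of the distance between `y` and data point `i`. -/
def Silent (h : Fin (64 * n) → Fin k₁ → Fin (2 ^ (W + W)))
    (G : Fin k₁ → EuclideanSpace ℝ (Fin d)) (y : GridPoint d Φ) (i : Fin n) : Prop :=
  ∀ l, T.levelEstimate κ W L h G y i l = none

open Classical in
/-- Some silent data point, if there is one. -/
noncomputable def silentIndex (h : Fin (64 * n) → Fin k₁ → Fin (2 ^ (W + W)))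
    (G : Fin k₁ → EuclideanSpace ℝ (Fin d)) (y : GridPoint d Φ) : Fin n :=
  if hs : ∃ i, T.Silent κ W L h G y i then hs.choose else 0

open Classical in
/-- The estimated distance between `y` and data point `i`: the estimate of some level, or else the
low-dimensional estimate for one of the silent points. -/
noncomputable def bobEstimate (h : Fin (64 * n) → Fin k₁ → Fin (2 ^ (W + W)))
    (c : Fin n → Fin k₂ → Fin (2 ^ (W + V))) (G : Fin k₁ → EuclideanSpace ℝ (Fin d))
    (H : Fin k₂ → EuclideanSpace ℝ (Fin d)) (y : GridPoint d Φ) (i : Fin n) : ℝ :=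
  if he : ∃ e l, T.levelEstimate κ W L h G y i l = some e then he.choose
  else (readOff κ (2 ^ 0) W V H (c (T.silentIndex κ W L h G y)) y).getD 0

/-- The angle codes of the active net points. -/
noncomputable def highCode (G : Fin k₁ → EuclideanSpace ℝ (Fin d)) (x : Fin n → GridPoint d Φ) :
    Fin (64 * n) → Fin k₁ → Fin (2 ^ (W + W)) :=
  T.store W L fun p => angleCode (2 ^ (W * p.1)) W W G (x p.2)

variable {T κ W L V}

theorem levelEstimate_highCode (hW : 0 < W) (G : Fin k₁ → EuclideanSpace ℝ (Fin d))
    (x : Fin n → GridPoint d Φ) (y : GridPoint d Φ) {i : Fin n} {l : Fin L}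
    (h : (l, T.rep W l i) ∈ T.activePairs W L) :
    T.levelEstimate κ W L (T.highCode W L G x) G y i l =
      readOff κ (2 ^ (W * l)) W W G (angleCode (2 ^ (W * l)) W W G (x (T.rep W l i))) y := by
  rw [levelEstimate, if_pos h, highCode, store_slot T hW _ h]

theorem resolution_le (hκ : 2 * Real.pi / 2 ^ W ≤ κ) (l : ℕ) :
    resolution W l ≤ κ / 6 * 2 ^ (W * l) := by
  have hπ := Real.pi_gt_three
  have hW : (0 : ℝ) < 2 ^ W := by positivity
  rw [div_le_iff₀ hW] at hκ
  rw [resolution, div_le_iff₀ hW, ← pow_mul]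
  have : (0 : ℝ) < 2 ^ (W * l) := by positivity
  nlinarith

/-- Passing to the representative costs at most `κ / 6 * 2 ^ (W * l)`, while an estimate read off at
level `l` is at least `2 ^ (W * l) / 2`. Since the samples are accurate at all scales, any level
that answers may be trusted, whether or not it is the level of the distance. -/
theorem IsSpanning.abs_sub_le_of_levelEstimate {x : Fin n → GridPoint d Φ} (hT : T.IsSpanning x)
    {G : Fin k₁ → EuclideanSpace ℝ (Fin d)} {y : GridPoint d Φ} (hk : 0 < k₁) (hW : 0 < W)
    (hκ4 : κ ≤ 1 / 4000) (hκ : 2 * Real.pi / 2 ^ W ≤ κ)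
    (hG : ∀ i, AccurateAll κ (W * L) G (gridVec (x i) - gridVec y)) {i : Fin n} {l : Fin L}
    {e : ℝ} (he : T.levelEstimate κ W L (T.highCode W L G x) G y i l = some e) :
    |e - gridDist (x i) y| ≤ 6401 * κ * e := by
  by_cases h : (l, T.rep W l i) ∈ T.activePairs W L
  · rw [levelEstimate_highCode hW G x y h] at he
    have hJ : W * l + W ≤ W * L := by
      calc W * l + W = W * (l + 1) := by ring
        _ ≤ W * L := Nat.mul_le_mul_left _ l.2
    obtain ⟨h1, h2⟩ := abs_sub_gridDist_le_of_readOff hk hκ4 hκ hJ (hG _) he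
    have h3 := (hT.dist_rep_lt W l i).le.trans (resolution_le hκ l)
    have h4 : |gridDist (x (T.rep W l i)) y - gridDist (x i) y|
        ≤ gridDist (x i) (x (T.rep W l i)) := by
      rw [abs_sub_comm]
      exact abs_gridDist_sub_le _ _ _
    have hκ0 : 0 < κ := lt_of_lt_of_le (by positivity) hκ
    have h5 := abs_sub_le e (gridDist (x (T.rep W l i)) y) (gridDist (x i) y)
    have h6 := mul_le_mul_of_nonneg_left h2 hκ0.le
    have h7 : 0 ≤ κ * 2 ^ (W * (l : ℕ)) := by positivity
    linarith
  · rw [levelEstimate, if_neg h] at he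
    simp at he

/-- A silent point is, up to a factor close to one, as close to `y` as any other point. -/
theorem IsSpanning.sub_le_of_silent {x : Fin n → GridPoint d Φ} (hT : T.IsSpanning x)
    {G : Fin k₁ → EuclideanSpace ℝ (Fin d)} {y : GridPoint d Φ} (hk : 0 < k₁) (hW : 0 < W)
    (hκ4 : κ ≤ 1 / 4000) (hκ : 2 * Real.pi / 2 ^ W ≤ κ)
    (hL : ∀ i, gridDist (x i) y < 2 ^ (W * L))
    (hG : ∀ i, AccurateAll κ (W * L) G (gridVec (x i) - gridVec y)) {i : Fin n}
    (hi : T.Silent κ W L (T.highCode W L G x) G y i) (j : Fin n) :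
    gridDist (x i) y - gridDist (x j) y ≤ κ * gridDist (x i) y := by
  have hκ0 : 0 < κ := lt_of_lt_of_le (by positivity) hκ
  rcases lt_or_ge (gridDist (x i) y) (gridDist (x j) y) with hlt | hji
  · have := mul_nonneg hκ0.le (gridDist_nonneg (x i) y)
    linarith
  by_cases h0 : gridDist (x i) y = 0
  · rw [h0]
    have := gridDist_nonneg (x j) y
    linarith
  have h1 := one_le_gridDist h0
  have hlow := two_pow_nearScale_le h1
  have hup := lt_two_pow_nearScale (gridDist (x i) y)
  set D := gridDist (x i) y with hD
  have hlt : nearScale D < W * L := by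
    have : (2 : ℝ) ^ nearScale D < 2 ^ (W * L) := hlow.trans_lt (hL i)
    exact (pow_lt_pow_iff_right₀ (by norm_num : (1 : ℝ) < 2)).1 this
  set l := nearScale D / W with hl
  set c := nearScale D % W with hc
  have hlc : W * l + c = nearScale D := Nat.div_add_mod _ _
  have hcW : c < W := Nat.mod_lt _ hW
  have hlL : l < L := Nat.div_lt_of_lt_mul hlt
  have hJ : W * l + W ≤ W * L := by
    calc W * l + W = W * (l + 1) := by ring
      _ ≤ W * L := Nat.mul_le_mul_left _ hlL
  rw [← hlc, pow_add] at hlow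
  rw [← hlc, pow_succ, pow_add] at hup
  have h2c : (1 : ℝ) ≤ 2 ^ c := one_le_pow₀ (by norm_num)
  have h2l : (0 : ℝ) < 2 ^ (W * l) := by positivity
  have hs : (2 : ℝ) ^ (W * l) ≤ 2 ^ (W * l) * 2 ^ c := by nlinarith
  have hres := resolution_le hκ l
  have hrepi := hT.dist_rep_lt W l i
  -- The representative is so close to `x i` that its distance to `y` is within the readable range
  -- at scale `2 ^ (W * l) * 2 ^ c`. Were it active, level `l` would have answered.
  have hinactive : T.rep W l i ∉ T.active W l := by
    intro hact
    have hmem : ((⟨l, hlL⟩ : Fin L), T.rep W l i) ∈ T.activePairs W L := by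
      simp only [activePairs, Finset.mem_filter, Finset.mem_univ, true_and]
      exact hact
    have h4 : |gridDist (x (T.rep W l i)) y - D| ≤ gridDist (x i) (x (T.rep W l i)) := by
      rw [abs_sub_comm]
      exact abs_gridDist_sub_le _ _ _
    have h5 := abs_le.1 h4
    have hpos : (0 : ℝ) < 2 ^ (W * l) * 2 ^ c := by positivity
    obtain ⟨e, he⟩ := exists_readOff_eq_some (i := c) hk hκ hJ (hG (T.rep W l i)) hcW
      (by rw [le_div_iff₀ hpos]; nlinarith) (by rw [div_le_iff₀ hpos]; nlinarith)
    have := hi ⟨l, hlL⟩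
    rw [levelEstimate_highCode hW G x y hmem, he] at this
    simp at this
  -- Both points lie within `D < B ^ (l + 1)` of `y`, where `B = 2 ^ W`; this is why the linking
  -- threshold is `2 * B ^ (l + 1)`.
  have hij : gridDist (x i) (x j) ≤ 2 * (2 ^ W) ^ (l + 1) := by
    have htri : gridDist (x i) (x j) ≤ D + gridDist (x j) y := by
      rw [gridDist_comm (x j)]
      exact gridDist_triangle _ _ _
    have : (2 : ℝ) ^ (W * l) * 2 ^ c * 2 ≤ (2 ^ W) ^ (l + 1) := by
      calc (2 : ℝ) ^ (W * l) * 2 ^ c * 2 = 2 ^ (W * l) * 2 ^ (c + 1) := by ring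
        _ ≤ 2 ^ (W * l) * 2 ^ W := by
          gcongr
          · norm_num
          · omega
        _ = (2 ^ W) ^ (l + 1) := by rw [pow_mul]; ring
    linarith
  have hresτ : resolution W l ≤ 2 * (2 ^ W) ^ (l + 1) := by
    have hW1 : (1 : ℝ) ≤ 2 ^ W := one_le_pow₀ (by norm_num)
    have hB : (0 : ℝ) < (2 ^ W) ^ l := by positivity
    rw [resolution, div_le_iff₀ (by positivity), pow_succ]
    nlinarith [mul_le_mul hW1 hW1 zero_le_one (by positivity)]
  have hrep : T.rep W l j = T.rep W l i :=
    netPoint_eq_of_not_mem_activeNet T.weight_nonneg (resolution_pos W l) hresτ hinactive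
      (hT.linked i j _ hij)
  have hrepj := hT.dist_rep_lt W l j
  rw [hrep] at hrepj
  have htri : D ≤ gridDist (x i) (x (T.rep W l i)) + gridDist (x j) (x (T.rep W l i))
      + gridDist (x j) y := by
    have h1 := gridDist_triangle (x i) (x (T.rep W l i)) y
    have h2 := gridDist_triangle (x (T.rep W l i)) (x j) y
    rw [gridDist_comm (x (T.rep W l i)) (x j)] at h2
    linarith
  nlinarith

/-- If no level answers, `sub_le_of_silent` is applied in both directions between `i` and the chosen
silent point, so the second code need be accurate only at the latter. The increase from `6400` to
`6500` absorbs the discrepancy between the two distances. -/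
theorem IsSpanning.abs_bobEstimate_sub_le {x : Fin n → GridPoint d Φ} (hT : T.IsSpanning x)
    {G : Fin k₁ → EuclideanSpace ℝ (Fin d)} {H : Fin k₂ → EuclideanSpace ℝ (Fin d)}
    {y : GridPoint d Φ} (hk₁ : 0 < k₁) (hk₂ : 0 < k₂) (hW : 0 < W)
    (hκ4 : κ ≤ 1 / 100000) (hκ : 2 * Real.pi / 2 ^ W ≤ κ)
    (hL : ∀ i, gridDist (x i) y < 2 ^ (W * L)) (hV : ∀ i, gridDist (x i) y < 2 ^ V)
    (hG : ∀ i, AccurateAll κ (W * L) G (gridVec (x i) - gridVec y))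
    (hH : AccurateNear κ H
      (gridVec (x (T.silentIndex κ W L (T.highCode W L G x) G y)) - gridVec y)) (i : Fin n) :
    |T.bobEstimate κ W L V (T.highCode W L G x) (fun i => angleCode (2 ^ 0) W V H (x i)) G H y i
      - gridDist (x i) y| ≤ 6500 * κ *
      T.bobEstimate κ W L V (T.highCode W L G x) (fun i => angleCode (2 ^ 0) W V H (x i)) G H y i
      := by
  have hκ0 : 0 < κ := lt_of_lt_of_le (by positivity) hκ
  unfold bobEstimate
  split_ifs with he
  · obtain ⟨l, hl⟩ := he.choose_spec
    have := hT.abs_sub_le_of_levelEstimate hk₁ hW (by linarith) hκ hG hl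
    have h0 := (abs_nonneg _).trans this
    have : 0 ≤ he.choose := by
      by_contra! hneg
      nlinarith
    nlinarith
  · have hi : T.Silent κ W L (T.highCode W L G x) G y i := by
      intro l
      by_contra hne
      obtain ⟨e, he'⟩ := Option.ne_none_iff_exists'.1 hne
      exact he ⟨e, l, he'⟩
    have hex : ∃ i, T.Silent κ W L (T.highCode W L G x) G y i := ⟨i, hi⟩
    set i₀ := T.silentIndex κ W L (T.highCode W L G x) G y with hi₀
    have hsil : T.Silent κ W L (T.highCode W L G x) G y i₀ := by
      rw [hi₀, silentIndex, dif_pos hex]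
      exact hex.choose_spec
    have h1 := hT.sub_le_of_silent hk₁ hW (by linarith) hκ hL hG hi i₀
    have h2 := hT.sub_le_of_silent hk₁ hW (by linarith) hκ hL hG hsil i
    have h3 := abs_getD_readOff_sub_le hk₂ (by linarith) hκ (hV i₀) hH
    set e := (readOff κ (2 ^ 0) W V H (angleCode (2 ^ 0) W V H (x i₀)) y).getD 0
    have h0 := (abs_nonneg _).trans h3
    have he0 : 0 ≤ e := by
      by_contra! hneg
      nlinarith
    have h4 := abs_le.1 h3
    have hD0 : gridDist (x i₀) y ≤ 2 * e := by nlinarith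
    have hDi := gridDist_nonneg (x i) y
    have hD : gridDist (x i) y ≤ 4 * e := by nlinarith
    rw [abs_le]
    constructor <;> nlinarith

end WeightedEdges

/-- The error is relative to the estimate; the margin `6500 * κ ≤ ε / 10` makes it relative to the
distance. -/
theorem mul_le_and_le_mul_of_abs_sub_le {ε κ e D : ℝ} (hε : 0 < ε) (hε1 : ε < 1)
    (hκ : κ = ε / 100000) (hD : 0 ≤ D) (h : |e - D| ≤ 6500 * κ * e) :
    (1 - ε) * D ≤ e ∧ e ≤ (1 + ε) * D := by
  have hκ0 : 0 < κ := by rw [hκ]; positivity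
  have h0 := (abs_nonneg _).trans h
  have he0 : 0 ≤ e := by
    by_contra! hneg
    nlinarith
  have h1 := abs_le.1 h
  have hc : 6500 * κ ≤ ε / 10 := by rw [hκ]; linarith
  have h2 : 6500 * κ * e ≤ ε / 10 * e := by gcongr
  constructor
  · have : (1 - ε) * D ≤ (1 - ε) * (e + ε / 10 * e) := by
      gcongr
      linarith
    nlinarith [mul_nonneg hε.le he0]
  · have : (1 + ε) * (e - ε / 10 * e) ≤ (1 + ε) * D := by
      gcongr; linarith
    nlinarith [mul_nonneg hε.le he0, mul_nonneg hε.le (mul_nonneg hε.le he0)]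

end Decoding

/-! ### Protocols from seeds -/

/-- A protocol whose sketch encodes a uniformly random seed and a function of the seed and the data
points. -/
theorem exists_protocol_of_seeds {n q d Φ b : ℕ} {ε δ : ℝ} {S M : Type*} [Fintype S] [Nonempty S]
    [Fintype M] [Nonempty M] (hM : Fintype.card M ≤ 2 ^ b)
    (encode : S → (Fin n → GridPoint d Φ) → M)
    (decode : M → (Fin q → GridPoint d Φ) → Fin n → Fin q → ℝ)
    (h : ∀ x y, (Nat.card {s // decode (encode s x) y ∉ GoodEstimates ε x y} : ℝ)
      ≤ δ * Fintype.card S) :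
    ∃ π : OneWayProtocol n q d Φ b, π.SolvesAllCrossDistances ε δ := by
  classical
  obtain ⟨φ⟩ : Nonempty (M ↪ (Fin b → Bool)) :=
    Function.Embedding.nonempty_of_card_le (by simpa using hM)
  refine ⟨⟨fun x => (PMF.uniformOfFintype S).map fun s => φ (encode s x),
    fun c y => PMF.pure (decode (Function.invFun φ c) y)⟩, fun x y => ?_⟩
  have hout : (PMF.map (fun s => φ (encode s x)) (PMF.uniformOfFintype S)).bind
      (fun c => PMF.pure (decode (Function.invFun φ c) y))
      = (PMF.uniformOfFintype S).map fun s => decode (encode s x) y := by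
    rw [PMF.bind_map, ← PMF.bind_pure_comp]
    congr 1
    funext s
    simp [Function.leftInverse_invFun φ.injective _]
  simp only [OneWayProtocol.output]
  rw [hout, PMF.toOuterMeasure_map_apply, PMF.toOuterMeasure_uniformOfFintype_apply]
  have hS : (0 : ℝ) < Fintype.card S := by exact_mod_cast Fintype.card_pos
  set A := (fun s => decode (encode s x) y) ⁻¹' GoodEstimates ε x y with hA
  have hsum : (Fintype.card A : ℝ)
      + Nat.card {s // decode (encode s x) y ∉ GoodEstimates ε x y} = Fintype.card S := by
    rw [Nat.card_eq_fintype_card]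
    have := Fintype.card_subtype_compl (fun s => s ∈ A)
    have hle := Fintype.card_subtype_le (fun s => s ∈ A)
    have h2 : Fintype.card {s // decode (encode s x) y ∉ GoodEstimates ε x y}
      = Fintype.card {s // ¬ s ∈ A} := Fintype.card_congr (Equiv.refl _)
    have h3 : Fintype.card A = Fintype.card {s // s ∈ A} := Fintype.card_congr (Equiv.refl _)
    rw [h2, h3]
    exact_mod_cast (by omega : Fintype.card {s // s ∈ A} + Fintype.card {s // ¬ s ∈ A}
      = Fintype.card S)
  have hx := h x y
  have hreal : 1 - δ ≤ (Fintype.card A : ℝ) / Fintype.card S := by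
    rw [le_div_iff₀ hS]
    linarith
  calc ENNReal.ofReal (1 - δ) ≤ ENNReal.ofReal ((Fintype.card A : ℝ) / Fintype.card S) :=
        ENNReal.ofReal_le_ofReal hreal
    _ = _ := by
      rw [ENNReal.ofReal_div_of_pos hS, ENNReal.ofReal_natCast, ENNReal.ofReal_natCast]

theorem card_gridPoint (d Φ : ℕ) : Fintype.card (GridPoint d Φ) = (2 * Φ + 1) ^ d := by
  have : ((Φ : ℤ) + 1 + Φ).toNat = 2 * Φ + 1 := by omega
  simp [Fintype.card_pi, this]

/-- The protocol that sends the data points themselves. -/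
theorem exists_exact_protocol {n q d Φ b : ℕ} {ε δ : ℝ} (hε : 0 ≤ ε) (hδ : 0 ≤ δ)
    (hb : (2 * Φ + 1) ^ (d * n) ≤ 2 ^ b) :
    ∃ π : OneWayProtocol n q d Φ b, π.SolvesAllCrossDistances ε δ := by
  have hcard : Fintype.card (Fin n → GridPoint d Φ) = (2 * Φ + 1) ^ (d * n) := by
    rw [Fintype.card_fun, card_gridPoint, Fintype.card_fin, pow_mul]
  have : Nonempty (GridPoint d Φ) := ⟨fun _ => ⟨0, by simp⟩⟩
  refine exists_protocol_of_seeds (S := Unit) (M := Fin n → GridPoint d Φ) (hcard.trans_le hb)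
    (fun _ x => x) (fun x y i j => gridDist (x i) (y j)) fun x y => ?_
  have hmem : (fun i j => gridDist (x i) (y j)) ∈ GoodEstimates ε x y := by
    intro i j
    have := mul_nonneg hε (gridDist_nonneg (x i) (y j))
    constructor <;> nlinarith
  have hempty : IsEmpty {s : Unit // (fun i j => gridDist (x i) (y j)) ∉ GoodEstimates ε x y} :=
    ⟨fun s => s.2 hmem⟩
  rw [Nat.card_of_isEmpty]
  simpa using hδ

theorem natCard_subtype_eq_sum_ite {X : Type*} [Fintype X] (p : X → Prop) [DecidablePred p] :
    (Nat.card {x // p x} : ℝ) = ∑ x, if p x then (1 : ℝ) else 0 := by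
  rw [Nat.card_eq_fintype_card, Fintype.card_subtype, Finset.sum_boole]

/-- A two-stage union bound. The event `Q` may depend on the first seed, because `hQ` holds for each
fixed one; so the second seed pays for `J` only, not for `I × J`. -/
theorem card_bad_pairs_le {A B I J : Type*} [Fintype A] [Fintype B] [Fintype I] [Fintype J]
    {bad : A × B → Prop} {P : A → I → J → Prop} {Q : A → B → J → Prop} {η₁ η₂ : ℝ}
    (hbad : ∀ a b, bad (a, b) → (∃ i j, P a i j) ∨ ∃ j, Q a b j)
    (hP : ∀ i j, (Nat.card {a // P a i j} : ℝ) ≤ η₁ * Fintype.card A)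
    (hQ : ∀ a j, (Nat.card {b // Q a b j} : ℝ) ≤ η₂ * Fintype.card B) :
    (Nat.card {p // bad p} : ℝ) ≤
      (Fintype.card I * Fintype.card J * η₁ + Fintype.card J * η₂)
        * (Fintype.card A * Fintype.card B) := by
  classical
  simp only [natCard_subtype_eq_sum_ite] at hP hQ
  rw [natCard_subtype_eq_sum_ite, Fintype.sum_prod_type]
  have hpt : ∀ a b, (if bad (a, b) then (1 : ℝ) else 0) ≤
      (∑ i, ∑ j, if P a i j then (1 : ℝ) else 0) + ∑ j, if Q a b j then (1 : ℝ) else 0 := by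
    intro a b
    have h1 : ∀ i, 0 ≤ ∑ j, if P a i j then (1 : ℝ) else 0 := fun i =>
      Finset.sum_nonneg fun j _ => by split_ifs <;> norm_num
    have h2 : 0 ≤ ∑ j, if Q a b j then (1 : ℝ) else 0 :=
      Finset.sum_nonneg fun j _ => by split_ifs <;> norm_num
    have h1' := Finset.sum_nonneg fun i (_ : i ∈ Finset.univ) => h1 i
    split_ifs with h
    · rcases hbad a b h with ⟨i, j, hij⟩ | ⟨j, hj⟩
      · have h3 : (1 : ℝ) ≤ ∑ j, if P a i j then (1 : ℝ) else 0 := by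
          refine le_trans (by rw [if_pos hij]) (Finset.single_le_sum
            (f := fun j => if P a i j then (1 : ℝ) else 0)
            (fun j _ => by split_ifs <;> norm_num) (Finset.mem_univ j))
        have h4 := Finset.single_le_sum (f := fun i => ∑ j, if P a i j then (1 : ℝ) else 0)
          (fun i _ => h1 i) (Finset.mem_univ i)
        linarith
      · have h3 : (1 : ℝ) ≤ ∑ j, if Q a b j then (1 : ℝ) else 0 := by
          refine le_trans (by rw [if_pos hj]) (Finset.single_le_sum
            (f := fun j => if Q a b j then (1 : ℝ) else 0)
            (fun j _ => by split_ifs <;> norm_num) (Finset.mem_univ j))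
        linarith
    · linarith
  have hPsum : ∑ a, ∑ i, ∑ j, (if P a i j then (1 : ℝ) else 0)
      ≤ Fintype.card I * Fintype.card J * (η₁ * Fintype.card A) := by
    rw [Finset.sum_comm]
    calc ∑ i, ∑ a, ∑ j, (if P a i j then (1 : ℝ) else 0)
        = ∑ i, ∑ j, ∑ a, (if P a i j then (1 : ℝ) else 0) :=
          Finset.sum_congr rfl fun i _ => Finset.sum_comm
      _ ≤ ∑ _i : I, ∑ _j : J, η₁ * Fintype.card A :=
          Finset.sum_le_sum fun i _ => Finset.sum_le_sum fun j _ => hP i j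
      _ = _ := by simp [mul_assoc]
  have hQsum : ∑ a, ∑ b, ∑ j, (if Q a b j then (1 : ℝ) else 0)
      ≤ Fintype.card A * (Fintype.card J * (η₂ * Fintype.card B)) := by
    calc ∑ a, ∑ b, ∑ j, (if Q a b j then (1 : ℝ) else 0)
        = ∑ a, ∑ j, ∑ b, (if Q a b j then (1 : ℝ) else 0) :=
          Finset.sum_congr rfl fun a _ => Finset.sum_comm
      _ ≤ ∑ _a : A, ∑ _j : J, η₂ * Fintype.card B :=
          Finset.sum_le_sum fun a _ => Finset.sum_le_sum fun j _ => hQ a j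
      _ = _ := by simp
  calc _ ≤ ∑ a, ∑ b, ((∑ i, ∑ j, if P a i j then (1 : ℝ) else 0)
        + ∑ j, if Q a b j then (1 : ℝ) else 0) :=
        Finset.sum_le_sum fun a _ => Finset.sum_le_sum fun b _ => hpt a b
    _ = Fintype.card B * (∑ a, ∑ i, ∑ j, if P a i j then (1 : ℝ) else 0)
        + ∑ a, ∑ b, ∑ j, (if Q a b j then (1 : ℝ) else 0) := by
        simp only [Finset.sum_add_distrib, Finset.sum_const, Finset.card_univ, nsmul_eq_mul]
        rw [← Finset.mul_sum]
    _ ≤ Fintype.card B * (Fintype.card I * Fintype.card J * (η₁ * Fintype.card A))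
        + Fintype.card A * (Fintype.card J * (η₂ * Fintype.card B)) := by gcongr
    _ = _ := by ring

/-- The protocol with `2 ^ τ₁` and `2 ^ τ₂` seeds, dimensions `k₁` and `k₂`, and levels of width
`W`. -/
theorem exists_level_protocol {n q d Φ W V k₁ k₂ τ₁ τ₂ a c : ℕ} {ε δ κ : ℝ} (hn : 0 < n)
    (hq : 0 < q) (hε : 0 < ε) (hε1 : ε < 1) (hδ : 0 < δ) (hκε : κ = ε / 100000)
    (hW : 2 * Real.pi / 2 ^ W ≤ κ) (hV : V = Nat.log 2 (2 * d * Φ) + 1)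
    (hk₁ : 2 * ((W * V : ℕ) : ℝ) * Real.exp (-(k₁ * κ ^ 2 / 2)) ≤ δ / (2 * n * q) / 2)
    (hτ₁ : 2 * (((2 * Φ + 1) ^ (2 * d) : ℕ) : ℝ)
      * Real.exp (-((2 ^ τ₁ : ℕ) * (δ / (2 * n * q) / 2) ^ 2 / 2)) < 1)
    (hk₂ : 8 * Real.exp (-(k₂ * κ ^ 2 / 2)) ≤ δ / (2 * q) / 2)
    (hτ₂ : 2 * (((2 * Φ + 1) ^ (2 * d) : ℕ) : ℝ)
      * Real.exp (-((2 ^ τ₂ : ℕ) * (δ / (2 * q) / 2) ^ 2 / 2)) < 1)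
    (hk₁0 : 0 < k₁) (hk₂0 : 0 < k₂) (ha : n ≤ 2 ^ a) (hc : 4 * d * Φ ^ 2 + 1 ≤ 2 ^ c) :
    ∃ π : OneWayProtocol n q d Φ
      (τ₁ + τ₂ + n * (2 * a + c) + n * (k₂ * (W + V)) + 64 * n * (k₁ * (W + W))),
      π.SolvesAllCrossDistances ε δ := by
  have : NeZero n := ⟨hn.ne'⟩
  have hn' : (0 : ℝ) < n := by exact_mod_cast hn
  have hq' : (0 : ℝ) < q := by exact_mod_cast hq
  have hκ0 : 0 < κ := by rw [hκε]; positivity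
  have hκ5 : κ ≤ 1 / 100000 := by rw [hκε]; linarith
  have hW0 : 0 < W := by
    rcases Nat.eq_zero_or_pos W with h | h
    · rw [h] at hW
      have := Real.pi_gt_three
      norm_num at hW
      linarith
    · exact h
  have hZ : Fintype.card (GridPoint d Φ × GridPoint d Φ) = (2 * Φ + 1) ^ (2 * d) := by
    rw [Fintype.card_prod, card_gridPoint]
    ring
  obtain ⟨G, hG⟩ := exists_seeds_accurateAll (E := EuclideanSpace ℝ (Fin d))
    (fun z : GridPoint d Φ × GridPoint d Φ => gridVec z.1 - gridVec z.2)
    (J := W * V) (t := 2 ^ τ₁) hk₁0 (by positivity) hκ0.le (η := δ / (2 * n * q)) (by positivity)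
    hk₁ (by rw [hZ]; exact hτ₁)
  obtain ⟨H, hH⟩ := exists_seeds_accurateNear (E := EuclideanSpace ℝ (Fin d))
    (fun z : GridPoint d Φ × GridPoint d Φ => gridVec z.1 - gridVec z.2)
    (t := 2 ^ τ₂) hk₂0 (by positivity) hκ0.le (by linarith) (η := δ / (2 * q)) (by positivity)
    hk₂ (by rw [hZ]; exact hτ₂)
  choose T hT using exists_isSpanning (n := n) (d := d) (Φ := Φ)
  let S := Fin (2 ^ τ₁) × Fin (2 ^ τ₂)
  let M := S × WeightedEdges n (4 * d * Φ ^ 2) × (Fin n → Fin k₂ → Fin (2 ^ (W + V)))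
    × (Fin (64 * n) → Fin k₁ → Fin (2 ^ (W + W)))
  have hM : Fintype.card M ≤
      2 ^ (τ₁ + τ₂ + n * (2 * a + c) + n * (k₂ * (W + V)) + 64 * n * (k₁ * (W + W))) := by
    have h1 : Fintype.card M = 2 ^ τ₁ * 2 ^ τ₂ * ((n * n * (4 * d * Φ ^ 2 + 1)) ^ n
        * (((2 ^ (W + V)) ^ k₂) ^ n * ((2 ^ (W + W)) ^ k₁) ^ (64 * n))) := by
      simp [M, S, WeightedEdges]
    have h2 : (n * n * (4 * d * Φ ^ 2 + 1)) ^ n ≤ (2 ^ a * 2 ^ a * 2 ^ c) ^ n := by gcongr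
    rw [h1]
    calc _ ≤ 2 ^ τ₁ * 2 ^ τ₂ * ((2 ^ a * 2 ^ a * 2 ^ c) ^ n
        * (((2 ^ (W + V)) ^ k₂) ^ n * ((2 ^ (W + W)) ^ k₁) ^ (64 * n))) := by gcongr
      _ = _ := by
        simp only [← pow_mul, ← pow_add]
        congr 1
        ring
  have : Nonempty S := ⟨(⟨0, by positivity⟩, ⟨0, by positivity⟩)⟩
  have : Nonempty M := ⟨(⟨0, by positivity⟩, ⟨0, by positivity⟩), fun _ => ((0, 0), 0),
    fun _ _ => ⟨0, by positivity⟩, fun _ _ => ⟨0, by positivity⟩⟩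
  refine exists_protocol_of_seeds (S := S) (M := M) hM
    (fun s x => (s, T x, fun i => angleCode (2 ^ 0) W V (H s.2) (x i),
      (T x).highCode W V (G s.1) x))
    (fun m y i j => m.2.1.bobEstimate κ W V V m.2.2.2 m.2.2.1 (G m.1.1) (H m.1.2) (y j) i)
    fun x y => ?_
  have hdist : ∀ i j, gridDist (x i) (y j) < 2 ^ V := fun i j => by
    rw [hV]; exact gridDist_lt_two_pow _ _
  -- The number of levels is taken to be `V`, more than necessary. This is harmless: the number of
  -- slots does not depend on it, and `k₁` needs to grow only with the logarithm of the number `W *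
  -- V` of scales.
  have hdist' : ∀ i j, gridDist (x i) (y j) < 2 ^ (W * V) := fun i j =>
    (hdist i j).trans_le (pow_le_pow_right₀ (by norm_num) (Nat.le_mul_of_pos_left V hW0))
  have hbound := card_bad_pairs_le (A := Fin (2 ^ τ₁)) (B := Fin (2 ^ τ₂)) (I := Fin n)
    (J := Fin q)
    (bad := fun s : Fin (2 ^ τ₁) × Fin (2 ^ τ₂) =>
      (fun i j => (T x).bobEstimate κ W V V ((T x).highCode W V (G s.1) x)
      (fun i => angleCode (2 ^ 0) W V (H s.2) (x i)) (G s.1) (H s.2) (y j) i)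
        ∉ GoodEstimates ε x y)
    (P := fun s i j => ¬ AccurateAll κ (W * V) (G s) (gridVec (x i) - gridVec (y j)))
    (Q := fun s s' j => ¬ AccurateNear κ (H s') (gridVec (x ((T x).silentIndex κ W V
      ((T x).highCode W V (G s) x) (G s) (y j))) - gridVec (y j)))
    (η₁ := δ / (2 * n * q)) (η₂ := δ / (2 * q))
    (fun s s' hbad => by
      by_contra! hgood
      refine hbad fun i j => ?_
      have := (hT x).abs_bobEstimate_sub_le hk₁0 hk₂0 hW0 hκ5 hW (fun i => hdist' i j)
        (fun i => hdist i j) (fun i => hgood.1 i j) (hgood.2 j) i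
      exact mul_le_and_le_mul_of_abs_sub_le hε hε1 hκε (gridDist_nonneg _ _) this)
    (fun i j => by simpa using hG (x i, y j))
    -- Once the first seed is fixed, the silent index is fixed, so this concerns a single pair of
    -- grid points.
    (fun s j => by
      simpa using hH (x ((T x).silentIndex κ W V ((T x).highCode W V (G s) x) (G s) (y j)), y j))
  refine hbound.trans (le_of_eq ?_)
  rw [show Fintype.card S = Fintype.card (Fin (2 ^ τ₁)) * Fintype.card (Fin (2 ^ τ₂)) from
    Fintype.card_prod _ _]
  push_cast [Fintype.card_fin]
  field_simp
  ring

/-! ### Parameters and their logarithms -/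

theorem half_lt_log_two : (1 / 2 : ℝ) < Real.log 2 := by
  linarith [Real.log_two_gt_d9]

theorem natClog_two_le {m : ℕ} (hm : 1 ≤ m) : (Nat.clog 2 m : ℝ) ≤ 2 * Real.log m + 1 := by
  have hlog : 0 ≤ Real.log m := Real.log_natCast_nonneg m
  rcases Nat.lt_or_ge m 2 with h | h
  · rw [Nat.clog_of_right_le_one (by omega)]
    push_cast
    linarith
  · have h1 : 2 ^ (Nat.clog 2 m - 1) < m := Nat.pow_pred_clog_lt_self (by norm_num) (by omega)
    have hpos : 0 < Nat.clog 2 m := Nat.clog_pos (by norm_num) h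
    have h2 : ((Nat.clog 2 m - 1 : ℕ) : ℝ) * Real.log 2 ≤ Real.log m := by
      rw [← Real.log_pow]
      exact Real.log_le_log (by positivity) (by exact_mod_cast h1.le)
    rw [Nat.cast_sub hpos] at h2
    have := half_lt_log_two
    have h3 : (1 : ℝ) ≤ Nat.clog 2 m := by exact_mod_cast hpos
    push_cast at h2
    nlinarith

theorem natLog_two_le (m : ℕ) : (Nat.log 2 m : ℝ) ≤ 2 * Real.log m := by
  rcases Nat.eq_zero_or_pos m with rfl | hm
  · simp
  have h2 : (Nat.log 2 m : ℝ) * Real.log 2 ≤ Real.log m := by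
    rw [← Real.log_pow]
    exact Real.log_le_log (by positivity) (by exact_mod_cast Nat.pow_log_le_self 2 hm.ne')
  have := half_lt_log_two
  have h3 : (0 : ℝ) ≤ Nat.log 2 m := by positivity
  nlinarith

theorem log_le_of_le_two_pow {x : ℝ} {m : ℕ} (hx : 0 < x) (h : x ≤ 2 ^ m) : Real.log x ≤ m := by
  have h1 : Real.log x ≤ m * Real.log 2 := by
    rw [← Real.log_pow]
    exact Real.log_le_log hx h
  have h2 : Real.log 2 ≤ 1 := by linarith [Real.log_two_lt_d9]
  have h3 : (0 : ℝ) ≤ m := by positivity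
  nlinarith

theorem log_two_mul_add_one_le {Φ : ℕ} (hΦ : 1 ≤ Φ) :
    Real.log ((2 * Φ + 1 : ℕ) : ℝ) ≤ 2 + Real.log Φ := by
  have hΦ' : (1 : ℝ) ≤ Φ := by exact_mod_cast hΦ
  calc Real.log ((2 * Φ + 1 : ℕ) : ℝ) ≤ Real.log (4 * Φ) := by
        refine Real.log_le_log (by positivity) ?_
        push_cast
        linarith
    _ = Real.log 4 + Real.log Φ := Real.log_mul (by norm_num) (by positivity)
    _ ≤ 2 + Real.log Φ := by
        have := log_le_of_le_two_pow (x := 4) (m := 2) (by norm_num) (by norm_num)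
        push_cast at this
        linarith

theorem exists_exact_protocol_log {n q d Φ : ℕ} {ε δ : ℝ} (hε : 0 ≤ ε) (hδ : 0 ≤ δ)
    (hΦ : 1 ≤ Φ) :
    ∃ (b : ℕ) (π : OneWayProtocol n q d Φ b), π.SolvesAllCrossDistances ε δ ∧
      (b : ℝ) ≤ d * n * (5 + 2 * Real.log Φ) := by
  have hb : (2 * Φ + 1) ^ (d * n) ≤ 2 ^ (Nat.clog 2 (2 * Φ + 1) * (d * n)) := by
    exact pow_mul 2 (Nat.clog 2 (2 * Φ + 1)) (d * n) ▸
      Nat.pow_le_pow_left (Nat.le_pow_clog one_lt_two _) _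
  obtain ⟨π, hπ⟩ := exists_exact_protocol (n := n) (q := q) hε hδ hb
  refine ⟨_, π, hπ, ?_⟩
  have h1 := natClog_two_le (m := 2 * Φ + 1) (by omega)
  have h2 := log_two_mul_add_one_le hΦ
  push_cast at h1 h2 ⊢
  rw [mul_comm]
  gcongr
  linarith

theorem exp_neg_le_one_div {x A : ℝ} (hA : 0 < A) (hx : Real.log A ≤ x) :
    Real.exp (-x) ≤ 1 / A := by
  rw [Real.exp_neg, one_div]
  exact inv_anti₀ hA ((Real.log_le_iff_le_exp hA).1 hx)

theorem exists_le_two_pow {A : ℝ} (hA : 1 ≤ A) :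
    ∃ m : ℕ, A ≤ 2 ^ m ∧ (m : ℝ) ≤ 2 * Real.log A + 3 := by
  refine ⟨Nat.clog 2 ⌈A⌉₊, (Nat.le_ceil _).trans ?_, ?_⟩
  · exact_mod_cast Nat.le_pow_clog one_lt_two ⌈A⌉₊
  · have hpos : 0 < ⌈A⌉₊ := Nat.ceil_pos.2 (by linarith)
    have h1 := natClog_two_le (m := ⌈A⌉₊) hpos
    have h2 : Real.log (⌈A⌉₊ : ℝ) ≤ Real.log (2 * A) := by
      refine Real.log_le_log (by exact_mod_cast hpos) ?_
      linarith [(Nat.ceil_lt_add_one (by linarith : 0 ≤ A)).le]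
    rw [Real.log_mul (by norm_num) (by linarith)] at h2
    linarith [Real.log_two_lt_d9]

theorem exists_dimension {κ A : ℝ} (hκ : 0 < κ) (hκ1 : κ ≤ 1) (hA : 1 ≤ A) :
    ∃ k : ℕ, 0 < k ∧ Real.exp (-(k * κ ^ 2 / 2)) ≤ 1 / A ∧
      (k : ℝ) ≤ 2 / κ ^ 2 * (Real.log A + 1) := by
  have hlog : 0 ≤ Real.log A := Real.log_nonneg hA
  have hx : 0 ≤ 2 / κ ^ 2 * Real.log A := by positivity
  refine ⟨⌈2 / κ ^ 2 * Real.log A⌉₊ + 1, Nat.succ_pos _,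
    exp_neg_le_one_div (by linarith) ?_, ?_⟩
  · have h1 : 2 / κ ^ 2 * Real.log A ≤ (⌈2 / κ ^ 2 * Real.log A⌉₊ + 1 : ℕ) := by
      push_cast
      linarith [Nat.le_ceil (2 / κ ^ 2 * Real.log A)]
    generalize ⌈2 / κ ^ 2 * Real.log A⌉₊ + 1 = k at h1 ⊢
    rw [div_mul_eq_mul_div, div_le_iff₀ (by positivity)] at h1
    linarith
  · have h2 : 2 ≤ 2 / κ ^ 2 := by
      rw [le_div_iff₀ (by positivity)]
      nlinarith
    have h1 := (Nat.ceil_lt_add_one hx).le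
    push_cast
    linarith

/-- A sufficient width of the levels. -/
theorem exists_width {ε : ℝ} (hε : 0 < ε) (hε1 : ε < 1) :
    ∃ W : ℕ, 2 * Real.pi / 2 ^ W ≤ ε / 100000 ∧ (W : ℝ) ≤ 31 + 2 * Real.log (1 / ε) := by
  have h5 : 1 < 1 / ε := by rw [lt_div_iff₀ hε]; linarith
  obtain ⟨W, h1, h2⟩ := exists_le_two_pow (A := 700000 * (1 / ε)) (by linarith)
  refine ⟨W, ?_, ?_⟩
  · rw [mul_one_div, div_le_iff₀ hε] at h1
    rw [div_le_iff₀ (by positivity)]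
    have := Real.pi_lt_d2
    linarith
  · rw [Real.log_mul (by norm_num) (by positivity)] at h2
    have h6 : Real.log 700000 ≤ 14 := by
      have h7 : Real.log 700000 ≤ Real.log (2 ^ 20) := Real.log_le_log (by norm_num) (by norm_num)
      rw [Real.log_pow] at h7
      have := Real.log_two_lt_d9
      push_cast at h7
      linarith
    linarith

/-- A sufficient number `2 ^ τ` of seeds. -/
theorem exists_seed_count {n q d Φ : ℕ} {δ : ℝ} (hn : 2 ≤ n) (hq : 0 < q) (hd : 1 ≤ d)
    (hΦ : 1 ≤ Φ) (hδ : 0 < δ) (hδ1 : δ < 1) (hnS : 31 * (1 + d + Real.log Φ) ≤ n) :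
    ∃ τ : ℕ, (∀ m : ℝ, 1 ≤ m → m ≤ n → 2 * (((2 * Φ + 1) ^ (2 * d) : ℕ) : ℝ)
        * Real.exp (-((2 ^ τ : ℕ) * (δ / (2 * m * q) / 2) ^ 2 / 2)) < 1) ∧
      (τ : ℝ) ≤ 13 + 8 * Real.log n + 4 * Real.log (q / δ) := by
  have hn' : (2 : ℝ) ≤ n := by exact_mod_cast hn
  have hn0 : (0 : ℝ) < n := by linarith
  have hq' : (1 : ℝ) ≤ q := by exact_mod_cast hq
  have hd' : (1 : ℝ) ≤ d := by exact_mod_cast hd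
  have hlΦ : 0 ≤ Real.log Φ := Real.log_nonneg (by exact_mod_cast hΦ)
  have hqδ : 1 < q / δ := by rw [lt_div_iff₀ hδ]; linarith
  -- With `2 ^ τ` at least this large, the exponent is at least `n ^ 2 * (n / m) ^ 2`, so one `τ`
  -- serves both `m = n` (first family) and `m = 1` (second family). By `hnS`, `n ^ 2` exceeds the
  -- logarithm of twice the number of pairs of grid points.
  have h32 : 1 ≤ 32 * (n : ℝ) ^ 4 * (q / δ) ^ 2 := by
    have h1 : (1 : ℝ) ≤ (n : ℝ) ^ 4 := one_le_pow₀ (by linarith)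
    have h2 : (1 : ℝ) ≤ (q / δ) ^ 2 := one_le_pow₀ hqδ.le
    nlinarith
  obtain ⟨τ, hτ, hτle⟩ := exists_le_two_pow h32
  refine ⟨τ, fun m hm1 hmn => ?_, ?_⟩
  · have hm0 : 0 < m := by linarith
    have hZ0 : (0 : ℝ) < 2 * (((2 * Φ + 1) ^ (2 * d) : ℕ) : ℝ) := by positivity
    have hZ : Real.log (2 * (((2 * Φ + 1) ^ (2 * d) : ℕ) : ℝ)) < n ^ 2 := by
      rw [Real.log_mul (by norm_num) (by positivity), Nat.cast_pow, Real.log_pow]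
      have h1 := log_two_mul_add_one_le hΦ
      have h2 := Real.log_two_lt_d9
      have h3 : (2 * d : ℕ) * Real.log ((2 * Φ + 1 : ℕ) : ℝ) ≤ 2 * d * (2 + Real.log Φ) := by
        push_cast at h1 ⊢
        gcongr
      have h5 : (31 * (1 + d + Real.log Φ)) ^ 2 ≤ (n : ℝ) ^ 2 := by gcongr
      nlinarith
    have h1 : (n : ℝ) ^ 2 ≤ (2 ^ τ : ℕ) * (δ / (2 * m * q) / 2) ^ 2 / 2 := by
      have h2 : (n : ℝ) ^ 2 ≤ 32 * n ^ 4 * (q / δ) ^ 2 * (δ / (2 * m * q) / 2) ^ 2 / 2 := by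
        have h3 : 32 * (n : ℝ) ^ 4 * (q / δ) ^ 2 * (δ / (2 * m * q) / 2) ^ 2 / 2
            = n ^ 2 * (n / m) ^ 2 := by field_simp; norm_num
        rw [h3]
        have h4 : 1 ≤ n / m := by rw [le_div_iff₀ hm0]; linarith
        have h5 : 1 ≤ (n / m) ^ 2 := one_le_pow₀ h4
        nlinarith [sq_nonneg (n : ℝ)]
      refine h2.trans ?_
      push_cast
      gcongr
    have h3 : 2 * (((2 * Φ + 1) ^ (2 * d) : ℕ) : ℝ)
        < Real.exp ((2 ^ τ : ℕ) * (δ / (2 * m * q) / 2) ^ 2 / 2) :=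
      (Real.log_lt_iff_lt_exp hZ0).1 (hZ.trans_le h1)
    rw [Real.exp_neg, ← div_eq_mul_inv, div_lt_one (Real.exp_pos _)]
    exact h3
  · have h2 := log_le_of_le_two_pow (x := 32) (m := 5) (by norm_num) (by norm_num)
    rw [Real.log_mul (by positivity) (by positivity), Real.log_mul (by norm_num) (by positivity),
      Real.log_pow, Real.log_pow] at hτle
    push_cast at hτle h2
    linarith

/-- A sufficient number of bits for the differences of squared distances. -/
theorem exists_index_bits {d Φ : ℕ} (hd : 1 ≤ d) (hΦ : 1 ≤ Φ) :
    ∃ c : ℕ, 4 * d * Φ ^ 2 + 1 ≤ 2 ^ c ∧ (c : ℝ) ≤ 4 * Real.log (d * Φ) + 9 := by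
  have hd' : (1 : ℝ) ≤ d := by exact_mod_cast hd
  have hΦ' : (1 : ℝ) ≤ Φ := by exact_mod_cast hΦ
  have h3 : (1 : ℝ) ≤ (d : ℝ) * Φ ^ 2 := one_le_mul_of_one_le_of_one_le hd' (one_le_pow₀ hΦ')
  obtain ⟨c, hc, hcle⟩ := exists_le_two_pow (A := (4 * d * Φ ^ 2 + 1 : ℕ)) (by
    push_cast
    linarith)
  refine ⟨c, by exact_mod_cast hc, ?_⟩
  have h2 : Real.log ((4 * d * Φ ^ 2 + 1 : ℕ) : ℝ) ≤ Real.log (8 * (d * Φ) ^ 2) := by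
    refine Real.log_le_log (by positivity) ?_
    push_cast
    have h4 : (d : ℝ) * Φ ^ 2 ≤ d * (d * Φ ^ 2) := le_mul_of_one_le_left (by positivity) hd'
    linarith
  rw [Real.log_mul (by norm_num) (by positivity), Real.log_pow] at h2
  have h8 := log_le_of_le_two_pow (x := 8) (m := 3) (by norm_num) (by norm_num)
  push_cast at h2 h8 hcle
  linarith

/-- The length of the message of the main protocol in terms of the logarithms of the parameters. -/
theorem exists_level_protocol_log {n q d Φ : ℕ} {ε δ : ℝ} (hn : 2 ≤ n)
    (hq : 0 < q) (hd : 1 ≤ d) (hΦ : 1 ≤ Φ) (hε : 0 < ε) (hε1 : ε < 1) (hδ : 0 < δ)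
    (hδ1 : δ < 1)
    (hnS : 31 * (1 + d + Real.log Φ + Real.log (1 / ε)) ≤ n) :
    ∃ (b : ℕ) (π : OneWayProtocol n q d Φ b), π.SolvesAllCrossDistances ε δ ∧
      (b : ℝ) ≤ 2 * (34 * Real.log n + 4 * Real.log (q / δ))
        + n * (34 * Real.log n + 4 * Real.log (d * Φ))
        + n * (2 * 10 ^ 10 / ε ^ 2 * (7 + Real.log (q / δ)) *
          (34 + 2 * Real.log (1 / ε) + 2 * Real.log (d * Φ)))
        + 64 * n * (2 * 10 ^ 10 / ε ^ 2 * (11 * Real.log n + Real.log (q / δ)) *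
          (2 * (31 + 2 * Real.log (1 / ε)))) := by
  have hn' : (2 : ℝ) ≤ n := by exact_mod_cast hn
  have hn0 : (0 : ℝ) < n := by linarith
  have hq' : (1 : ℝ) ≤ q := by exact_mod_cast hq
  have hd' : (1 : ℝ) ≤ d := by exact_mod_cast hd
  have hΦ' : (1 : ℝ) ≤ Φ := by exact_mod_cast hΦ
  have hlΦ : 0 ≤ Real.log Φ := Real.log_nonneg hΦ'
  have hld : 0 ≤ Real.log d := Real.log_nonneg hd'
  have hld' : Real.log d ≤ d - 1 := Real.log_le_sub_one_of_pos (by linarith)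
  have hX : Real.log (d * Φ) = Real.log d + Real.log Φ :=
    Real.log_mul (by positivity) (by positivity)
  have hln : 1 / 2 ≤ Real.log n :=
    half_lt_log_two.le.trans (Real.log_le_log (by norm_num) hn')
  have hΛ : 0 < Real.log (1 / ε) := Real.log_pos (by rw [lt_div_iff₀ hε]; linarith)
  have hqδ : 1 < q / δ := by rw [lt_div_iff₀ hδ]; linarith
  have hΔ : 0 < Real.log (q / δ) := Real.log_pos hqδ
  have hqδ0 : 0 < q / δ := by linarith
  set κ := ε / 100000 with hκ
  have hκ0 : 0 < κ := by positivity
  have hκ1 : κ ≤ 1 := by rw [hκ]; linarith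
  have hκε : 2 / κ ^ 2 = 2 * 10 ^ 10 / ε ^ 2 := by rw [hκ]; field_simp; norm_num
  set V := Nat.log 2 (2 * d * Φ) + 1 with hVdef
  obtain ⟨W, hW, hWle⟩ := exists_width hε hε1
  have hVle : (V : ℝ) ≤ 3 + 2 * Real.log (d * Φ) := by
    have h1 := natLog_two_le (2 * d * Φ)
    have h2 : ((2 * d * Φ : ℕ) : ℝ) = 2 * (d * Φ) := by push_cast; ring
    rw [h2, Real.log_mul (by norm_num) (by positivity)] at h1
    rw [hVdef, Nat.cast_add, Nat.cast_one]
    linarith [Real.log_two_lt_d9]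
  have hWn : (W : ℝ) ≤ n := by linarith
  have hVn : (V : ℝ) ≤ n := by linarith
  have hn1 : (1 : ℝ) ≤ (n : ℝ) ^ 3 := one_le_pow₀ (by linarith)
  -- In `n ^ 3`, two factors pay for the `W * V ≤ n ^ 2` scales and one for the data points; the
  -- queries are in `q / δ`. For `k₂` no power of `n` is needed.
  obtain ⟨k₁, hk₁0, hk₁e, hk₁le⟩ := exists_dimension hκ0 hκ1
    (A := 8 * n ^ 3 * (q / δ))
    (one_le_mul_of_one_le_of_one_le (by linarith) hqδ.le)
  obtain ⟨k₂, hk₂0, hk₂e, hk₂le⟩ := exists_dimension hκ0 hκ1 (A := 32 * (q / δ)) (by linarith)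
  have hA₁ : Real.log (8 * n ^ 3 * (q / δ)) + 1 ≤ 11 * Real.log n + Real.log (q / δ) := by
    have h8 := log_le_of_le_two_pow (x := 8) (m := 3) (by norm_num) (by norm_num)
    rw [Real.log_mul (by positivity) (by positivity), Real.log_mul (by norm_num) (by positivity),
      Real.log_pow]
    push_cast at h8 ⊢
    linarith
  have hA₂ : Real.log (32 * (q / δ)) + 1 ≤ 7 + Real.log (q / δ) := by
    have h8 := log_le_of_le_two_pow (x := 32) (m := 5) (by norm_num) (by norm_num)
    rw [Real.log_mul (by norm_num) (by positivity)]
    push_cast at h8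
    linarith
  have hk₁le' : (k₁ : ℝ) ≤ 2 * 10 ^ 10 / ε ^ 2 * (11 * Real.log n + Real.log (q / δ)) := by
    rw [← hκε]
    exact hk₁le.trans (by gcongr)
  have hk₂le' : (k₂ : ℝ) ≤ 2 * 10 ^ 10 / ε ^ 2 * (7 + Real.log (q / δ)) := by
    rw [← hκε]
    exact hk₂le.trans (by gcongr)
  obtain ⟨τ, hseeds, hτle⟩ := exists_seed_count hn hq hd hΦ hδ hδ1 (by linarith)
  obtain ⟨a, ha, hale⟩ := exists_le_two_pow (A := n) (by linarith)
  obtain ⟨c, hc, hcle⟩ := exists_index_bits hd hΦ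
  obtain ⟨π, hπ⟩ := exists_level_protocol (n := n) (q := q) (d := d) (Φ := Φ) (W := W) (V := V)
    (k₁ := k₁) (k₂ := k₂) (τ₁ := τ) (τ₂ := τ) (a := a) (c := c) (ε := ε) (δ := δ) (κ := κ)
    (by omega) hq hε hε1 hδ hκ hW hVdef
    (by
      have h2 : ((W * V : ℕ) : ℝ) ≤ n * n := by push_cast; gcongr
      calc 2 * ((W * V : ℕ) : ℝ) * Real.exp (-(k₁ * κ ^ 2 / 2))
          ≤ 2 * (n * n) * (1 / (8 * n ^ 3 * (q / δ))) := by gcongr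
        _ = δ / (2 * n * q) / 2 := by field_simp; norm_num)
    (hseeds n (by linarith) le_rfl)
    (by
      calc 8 * Real.exp (-(k₂ * κ ^ 2 / 2)) ≤ 8 * (1 / (32 * (q / δ))) := by gcongr
        _ = δ / (2 * q) / 2 := by field_simp; norm_num)
    (by simpa using hseeds 1 le_rfl (by linarith))
    hk₁0 hk₂0 (by exact_mod_cast ha) hc
  refine ⟨_, π, hπ, ?_⟩
  push_cast
  have hX0 : 0 ≤ Real.log (d * Φ) := by rw [hX]; positivity
  have e1 : (2 * a + c : ℝ) ≤ 34 * Real.log n + 4 * Real.log (d * Φ) := by linarith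
  have e2 : (W + V : ℝ) ≤ 34 + 2 * Real.log (1 / ε) + 2 * Real.log (d * Φ) := by linarith
  have e3 : (W + W : ℝ) ≤ 2 * (31 + 2 * Real.log (1 / ε)) := by linarith
  have e4 : (n * (2 * a + c) : ℝ) ≤ n * (34 * Real.log n + 4 * Real.log (d * Φ)) := by gcongr
  have e5 : (n * (k₂ * (W + V)) : ℝ) ≤ n * (2 * 10 ^ 10 / ε ^ 2 * (7 + Real.log (q / δ)) *
      (34 + 2 * Real.log (1 / ε) + 2 * Real.log (d * Φ))) := by gcongr
  have e6 : (64 * n * (k₁ * (W + W)) : ℝ) ≤ 64 * n * (2 * 10 ^ 10 / ε ^ 2 *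
      (11 * Real.log n + Real.log (q / δ)) * (2 * (31 + 2 * Real.log (1 / ε)))) := by gcongr
  linarith

/-! ### The final bound -/

theorem le_mul_mul_of_one_le {a u b : ℝ} (ha : 0 ≤ a) (h : 1 ≤ u * b) : a ≤ u * (a * b) := by
  nlinarith

/-- The arithmetic behind the main term: `t = n / ε ^ 2`, and the other variables stand for
logarithms. -/
theorem message_length_le {n t LN Λ X Δ lam₀ lam₁ : ℝ} (ht : 1 ≤ t) (hnt : n ≤ t)
    (hLN : 1 / 2 ≤ LN) (hlam₀ : 0 < lam₀) (hlam₁ : 0 < lam₁) (hΛ : lam₀ ≤ Λ) (hΔ : lam₁ ≤ Δ)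
    (hX : 1 / 2 ≤ X) (hΛX : Λ ≤ X) :
    2 * (34 * LN + 4 * Δ) + n * (34 * LN + 4 * X)
        + t * (2 * 10 ^ 10 * (7 + Δ) * (34 + 2 * Λ + 2 * X))
        + 64 * t * (2 * 10 ^ 10 * (11 * LN + Δ) * (2 * (31 + 2 * Λ)))
      ≤ 10 ^ 15 * (1 + 1 / lam₀ + 1 / lam₁) * (t * (LN * Λ + X * Δ)) := by
  set u := 1 / lam₀ with hu
  set v := 1 / lam₁ with hv
  have hu0 : 0 < u := by positivity
  have hv0 : 0 < v := by positivity
  have hΛ0 : 0 < Λ := by linarith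
  have hΔ0 : 0 < Δ := by linarith
  have hA0 : 0 ≤ LN * Λ := by positivity
  have hB0 : 0 ≤ X * Δ := by positivity
  have h1 : 1 ≤ u * Λ := by rw [hu, one_div_mul_eq_div, le_div_iff₀ hlam₀]; linarith
  have h2 : 1 ≤ v * Δ := by rw [hv, one_div_mul_eq_div, le_div_iff₀ hlam₁]; linarith
  have hLNA : LN ≤ u * (LN * Λ) := le_mul_mul_of_one_le (by linarith) h1
  have hXB : X ≤ v * (X * Δ) := le_mul_mul_of_one_le (by linarith) h2
  have hΔB : Δ ≤ 2 * (X * Δ) := by nlinarith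
  have huA : 0 ≤ u * (LN * Λ) := by positivity
  have huB : 0 ≤ u * (X * Δ) := by positivity
  have hvA : 0 ≤ v * (LN * Λ) := by positivity
  have hvB : 0 ≤ v * (X * Δ) := by positivity
  have e1 : 2 * (34 * LN + 4 * Δ) ≤ t * (68 * (u * (LN * Λ)) + 16 * (X * Δ)) := by
    calc 2 * (34 * LN + 4 * Δ) ≤ 1 * (68 * (u * (LN * Λ)) + 16 * (X * Δ)) := by linarith
      _ ≤ _ := by gcongr
  have e2 : n * (34 * LN + 4 * X) ≤ t * (34 * (u * (LN * Λ)) + 4 * (v * (X * Δ))) := by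
    gcongr
  have e3 : (7 + Δ) * (34 + 2 * Λ + 2 * X) ≤ 72 * (X * Δ) + 504 * (v * (X * Δ)) := by
    have h3 : 34 + 2 * Λ + 2 * X ≤ 72 * X := by linarith
    have h4 : (7 + Δ) * (34 + 2 * Λ + 2 * X) ≤ (7 + Δ) * (72 * X) := by gcongr
    linarith
  have e4 : (11 * LN + Δ) * (2 * (31 + 2 * Λ)) ≤
      44 * (LN * Λ) + 682 * (u * (LN * Λ)) + 128 * (X * Δ) := by
    -- The product `Δ * Λ` comes from the first code and is not among the target terms; this is
    -- where `Λ ≤ X` is indispensable.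
    have h5 : Δ * Λ ≤ X * Δ := by nlinarith
    linarith
  have e5 : t * (2 * 10 ^ 10 * (7 + Δ) * (34 + 2 * Λ + 2 * X))
      ≤ t * (2 * 10 ^ 10 * (72 * (X * Δ) + 504 * (v * (X * Δ)))) := by
    have := mul_le_mul_of_nonneg_left e3 (by positivity : 0 ≤ t * (2 * 10 ^ 10))
    linarith
  have e6 : 64 * t * (2 * 10 ^ 10 * (11 * LN + Δ) * (2 * (31 + 2 * Λ)))
      ≤ t * (64 * (2 * 10 ^ 10) *
        (44 * (LN * Λ) + 682 * (u * (LN * Λ)) + 128 * (X * Δ))) := by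
    have := mul_le_mul_of_nonneg_left e4 (by positivity : 0 ≤ 64 * t * (2 * 10 ^ 10))
    linarith
  have e7 : t * (68 * (u * (LN * Λ)) + 16 * (X * Δ)) + t * (34 * (u * (LN * Λ)) + 4 * (v * (X * Δ)))
      + t * (2 * 10 ^ 10 * (72 * (X * Δ) + 504 * (v * (X * Δ))))
      + t * (64 * (2 * 10 ^ 10) * (44 * (LN * Λ) + 682 * (u * (LN * Λ)) + 128 * (X * Δ)))
      ≤ t * (10 ^ 15 * (1 + u + v) * (LN * Λ + X * Δ)) := by
    rw [← mul_add, ← mul_add, ← mul_add]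
    gcongr
    linarith
  linarith

theorem theorem2 (ε₀ δ₀ : ℝ) (hε₀ : ε₀ < 1) (hδ₀ : δ₀ < 1) :
    ∃ (C : ℝ) (P : MvPolynomial (Fin 4) ℝ), 0 < C ∧
      ∀ (n q d Φ : ℕ) (ε δ : ℝ), 1 ≤ q → q ≤ n → 1 ≤ d → 1 ≤ Φ →
        0 < ε → ε ≤ ε₀ → 0 < δ → δ ≤ δ₀ →
        ∃ (b : ℕ) (π : OneWayProtocol n q d Φ b),
          π.SolvesAllCrossDistances ε δ ∧
          (b : ℝ) ≤
            C * ((n : ℝ) / ε ^ 2 *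
              (Real.log n * Real.log (1 / ε)
                + Real.log ((d : ℝ) * (Φ : ℝ)) * Real.log ((q : ℝ) / δ)))
            + MvPolynomial.eval
                ![(d : ℝ), Real.log Φ, Real.log ((q : ℝ) / δ), Real.log (1 / ε)] P := by
  -- The maximum keeps `ε₁` and `δ₁` positive, so that `lam₀` and `lam₁` are positive lower bounds
  -- for the logarithms, whatever the signs of `ε₀` and `δ₀`.
  set ε₁ := max ε₀ (1 / 2) with hε₁
  set δ₁ := max δ₀ (1 / 2) with hδ₁
  have hε₁1 : ε₁ < 1 := max_lt hε₀ (by norm_num)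
  have hδ₁1 : δ₁ < 1 := max_lt hδ₀ (by norm_num)
  have hε₁0 : 0 < ε₁ := lt_of_lt_of_le (by norm_num) (le_max_right _ _)
  have hδ₁0 : 0 < δ₁ := lt_of_lt_of_le (by norm_num) (le_max_right _ _)
  set lam₀ := Real.log (1 / ε₁) with hlam₀d
  set lam₁ := Real.log (1 / δ₁) with hlam₁d
  have hlam₀ : 0 < lam₀ := Real.log_pos (by rw [lt_div_iff₀ hε₁0]; linarith)
  have hlam₁ : 0 < lam₁ := Real.log_pos (by rw [lt_div_iff₀ hδ₁0]; linarith)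
  refine ⟨10 ^ 15 * (1 + 1 / lam₀ + 1 / lam₁),
    MvPolynomial.C 155 * (1 + MvPolynomial.X 0 + MvPolynomial.X 1 + MvPolynomial.X 2
      + MvPolynomial.X 3) ^ 3, by positivity, ?_⟩
  intro n q d Φ ε δ hq hqn hd hΦ hε hεε₀ hδ hδδ₀
  have hε1 : ε < 1 := by linarith
  have hδ1 : δ < 1 := by linarith
  have hn' : (1 : ℝ) ≤ n := by exact_mod_cast hq.trans hqn
  have hq' : (1 : ℝ) ≤ q := by exact_mod_cast hq
  have hd' : (1 : ℝ) ≤ d := by exact_mod_cast hd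
  have hΦ' : (1 : ℝ) ≤ Φ := by exact_mod_cast hΦ
  have hlΦ : 0 ≤ Real.log Φ := Real.log_nonneg hΦ'
  have hld : 0 ≤ Real.log d := Real.log_nonneg hd'
  have hX : Real.log (d * Φ) = Real.log d + Real.log Φ :=
    Real.log_mul (by positivity) (by positivity)
  have hΛ : lam₀ ≤ Real.log (1 / ε) := by
    refine Real.log_le_log (by positivity) ?_
    gcongr
    exact hεε₀.trans (le_max_left _ _)
  have hΔ : lam₁ ≤ Real.log (q / δ) := by
    refine Real.log_le_log (by positivity) ?_
    gcongr
    exact hδδ₀.trans (le_max_left _ _)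
  have hln : 0 ≤ Real.log n := Real.log_nonneg hn'
  simp only [map_mul, map_pow, map_add, map_one, MvPolynomial.eval_C, MvPolynomial.eval_X,
    Matrix.cons_val]
  set Λ := Real.log (1 / ε)
  set Δ := Real.log (q / δ)
  have hΛ0 : 0 < Λ := by linarith
  have hΔ0 : 0 < Δ := by linarith
  have hεsq : ε ^ 2 ≤ 1 := pow_le_one₀ hε.le hε1.le
  have hnt : (n : ℝ) ≤ n / ε ^ 2 := by
    rw [le_div_iff₀ (by positivity)]; nlinarith
  have hX0 : 0 ≤ Real.log (d * Φ) := by rw [hX]; positivity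
  rcases le_or_gt (n : ℝ) (31 * (1 + d + Real.log Φ + Δ + Λ)) with hsmall | hlarge
  -- For small `n` the exact protocol fits into the polynomial: `d ≤ S`, `n ≤ 31 * S` and `5 + 2 *
  -- log Φ ≤ 5 * S`, whence the coefficient `155`.
  · obtain ⟨b, π, hπ, hb⟩ := exists_exact_protocol_log (n := n) (q := q) (d := d) hε.le hδ.le hΦ
    refine ⟨b, π, hπ, hb.trans ?_⟩
    set S := 1 + (d : ℝ) + Real.log Φ + Δ + Λ
    have h1 : (d : ℝ) * n * (5 + 2 * Real.log Φ) ≤ S * (31 * S) * (5 * S) := by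
      gcongr
      · simp only [S]; linarith
      · simp only [S]; linarith
    have h2 : 0 ≤ 10 ^ 15 * (1 + 1 / lam₀ + 1 / lam₁) *
        (n / ε ^ 2 * (Real.log n * Λ + Real.log (d * Φ) * Δ)) := by positivity
    linarith
  have hP : 0 ≤ 155 * (1 + (d : ℝ) + Real.log Φ + Δ + Λ) ^ 3 := by positivity
  have hn2 : 2 ≤ n := by
    have : (2 : ℝ) ≤ n := by linarith
    exact_mod_cast this
  have hln2 : 1 / 2 ≤ Real.log n :=
    half_lt_log_two.le.trans (Real.log_le_log (by norm_num) (by exact_mod_cast hn2))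
  rcases lt_or_ge (d : ℝ) (1 / ε ^ 2) with hdε | hdε
  -- In dimension below `1 / ε ^ 2` the coordinates themselves cost at most `n / ε ^ 2` times `5 + 2
  -- * log Φ`, which the main term covers.
  · obtain ⟨b, π, hπ, hb⟩ := exists_exact_protocol_log (n := n) (q := q) (d := d) hε.le hδ.le hΦ
    refine ⟨b, π, hπ, hb.trans ?_⟩
    set u := 1 / lam₀ with hu
    set v := 1 / lam₁ with hv
    have hu0 : 0 < u := by positivity
    have hv0 : 0 < v := by positivity
    have h1 : 1 ≤ u * Λ := by rw [hu, one_div_mul_eq_div, le_div_iff₀ hlam₀]; linarith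
    have h2 : 1 ≤ v * Δ := by rw [hv, one_div_mul_eq_div, le_div_iff₀ hlam₁]; linarith
    have h3 : 5 + 2 * Real.log Φ ≤
        10 ^ 15 * (1 + u + v) * (Real.log n * Λ + Real.log (d * Φ) * Δ) := by
      have hA : Real.log n ≤ u * (Real.log n * Λ) := le_mul_mul_of_one_le hln h1
      have hB : Real.log (d * Φ) ≤ v * (Real.log (d * Φ) * Δ) :=
        le_mul_mul_of_one_le hX0 h2
      have hA0 : 0 ≤ Real.log n * Λ := by positivity
      have hB0 : 0 ≤ Real.log (d * Φ) * Δ := by positivity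
      have huB : 0 ≤ u * (Real.log (d * Φ) * Δ) := by positivity
      have hvA : 0 ≤ v * (Real.log n * Λ) := by positivity
      linarith
    calc (d : ℝ) * n * (5 + 2 * Real.log Φ)
        ≤ 1 / ε ^ 2 * n * (10 ^ 15 * (1 + u + v) * (Real.log n * Λ + Real.log (d * Φ) * Δ)) := by
          gcongr
      _ = 10 ^ 15 * (1 + u + v) * (n / ε ^ 2 * (Real.log n * Λ + Real.log (d * Φ) * Δ)) := by ring
      _ ≤ _ := by linarith
  · obtain ⟨b, π, hπ, hb⟩ := exists_level_protocol_log (n := n) (q := q) hn2 hq hd hΦ hε hε1 hδ hδ1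
      (by linarith)
    refine ⟨b, π, hπ, hb.trans ?_⟩
    -- High dimension forces `log (1 / ε)` below `log (d * Φ)`, the hypothesis that
    -- `message_length_le` needs.
    have hdε' : 2 * Λ ≤ Real.log d := by
      have h1 : Real.log (1 / ε ^ 2) ≤ Real.log d := Real.log_le_log (by positivity) hdε
      rwa [← one_div_pow, Real.log_pow, Nat.cast_ofNat] at h1
    have hd2 : 2 ≤ d := by
      have : (1 : ℝ) < d := by
        refine lt_of_lt_of_le ?_ hdε
        rw [lt_div_iff₀ (by positivity)]
        nlinarith
      exact_mod_cast this
    have hlogd : 1 / 2 ≤ Real.log d :=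
      half_lt_log_two.le.trans (Real.log_le_log (by norm_num) (by exact_mod_cast hd2))
    have := message_length_le (n := n) (t := n / ε ^ 2) (by linarith) hnt hln2 hlam₀
      hlam₁ hΛ hΔ (X := Real.log (d * Φ)) (by linarith) (by linarith)
    refine le_trans (le_of_eq ?_) (this.trans (by linarith))
    ring
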